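/- Let $\Omega\subset\mathbb{R}^n$ be a bounded open set and let $X_1,\dots,X_m$ be smooth vector fields on $\Omega$ (for instance the restrictions of a basis of the first layer of the left-invariant vector fields of a Carnot group $(\mathbb{R}^n,*)$). For a function $w$ write $\mathfrak{X}w=(X_1w,\dots,X_mw)$, let $\mathfrak{X}\mathfrak{X}^\star w$ be the symmetric $m\times m$ matrix with entries $\frac12(X_iX_jw+X_jX_iw)$, and put $$\mathcal{L}w=-\mathrm{Tr}\big(A(\mathfrak{X}w)\,\mathfrak{X}\mathfrak{X}^\star w\big)+H(\mathfrak{X}w),$$ where $A:\mathbb{R}^m\to\mathbb{R}^{m\times m}$ and $H:\mathbb{R}^m\to\mathbb{R}$ are continuous, $A(\xi)$ is symmetric and positive semi-definite for every $\xi$, $\langle A(\xi)\xi,\xi\rangle>0$ for every $\xi\neq0$, and, for some function $\phi:(0,1]\to(0,\infty)$, $$-\mathrm{Tr}\big(A(t\xi)M\big)\le\frac{-\mathrm{Tr}\big(A(\xi)M\big)}{t\,\phi(1/t)},\qquad H(t\xi)\le\frac{1}{\phi(1/t)}H(\xi)$$ for all $t\ge1$, all $\xi\in\mathbb{R}^m\setminus\{0\}$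 and all symmetric $M\in\mathbb{R}^{m\times m}$. A function $w\in C(\bar\Omega)$ is semi-convex if for some $\Lambda>0$ the function $w(x)+\frac12\Lambda|x|^2$ is convex (on every convex subset of $\Omega$), and semi-concave if $-w$ is semi-convex. The inequality $\mathcal{L}w\le0$ (resp. $\mathcal{L}w\ge0$) holds in the viscosity sense in $\Omega$ if $\mathcal{L}\varphi(x)\le0$ (resp. $\ge0$) for every $x\in\Omega$ and every $\varphi\in C^2(\Omega)$ with $\nabla\varphi(x)\ne0$ such that $w-\varphi$ attains its maximum (resp. minimum) over $\Omega$ at $x$. Let $u,v\in C(\bar\Omega)$ be semi-convex and semi-concave respectively, with $u\le v$ on $\partial\Omega$ and $\mathcal{L}u\le0\le\mathcal{L}v$ in $\Omega$ in the viscosity sense. If $\mathfrak{X}u$ vanishes at no point of $\Omega$ at which $u-v$ attains its maximum over $\Omega$, or if $\mathfrak{X}v$ vanishes at no such point, then $u\le v$ in $\Omega$. -/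

import Mathlib

open scoped Matrix ContDiff

noncomputable section

namespace SubElliptic

/-- Derivative `V f` of a function `f` along a vector field `V` on `ℝⁿ`. -/
def lieD {n : ℕ} (V : EuclideanSpace ℝ (Fin n) → EuclideanSpace ℝ (Fin n))
    (f : EuclideanSpace ℝ (Fin n) → ℝ) : EuclideanSpace ℝ (Fin n) → ℝ :=
  fun x => fderiv ℝ f x (V x)

/-- Sub-elliptic gradient `𝔛 f = (X₁ f, …, X_m f)`. -/
def subGrad {n m : ℕ} (X : Fin m → EuclideanSpace ℝ (Fin n) → EuclideanSpace ℝ (Fin n))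
    (f : EuclideanSpace ℝ (Fin n) → ℝ) (x : EuclideanSpace ℝ (Fin n)) : Fin m → ℝ :=
  fun j => lieD (X j) f x

/-- Symmetrized sub-elliptic second derivative, with entries `(X_i X_j f + X_j X_i f) / 2`. -/
def subHess {n m : ℕ} (X : Fin m → EuclideanSpace ℝ (Fin n) → EuclideanSpace ℝ (Fin n))
    (f : EuclideanSpace ℝ (Fin n) → ℝ) (x : EuclideanSpace ℝ (Fin n)) :
    Matrix (Fin m) (Fin m) ℝ :=
  Matrix.of fun i j => (lieD (X i) (lieD (X j) f) x + lieD (X j) (lieD (X i) f) x) / 2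

/-- The points of `Ω` at which `f` attains its maximum over `Ω`. -/
def argmaxOn {n : ℕ} (Ω : Set (EuclideanSpace ℝ (Fin n))) (f : EuclideanSpace ℝ (Fin n) → ℝ) :
    Set (EuclideanSpace ℝ (Fin n)) :=
  {x | x ∈ Ω ∧ ∀ y ∈ Ω, f y ≤ f x}

/-- The points of `Ω` at which `f` attains its minimum over `Ω`. -/
def argminOn {n : ℕ} (Ω : Set (EuclideanSpace ℝ (Fin n))) (f : EuclideanSpace ℝ (Fin n) → ℝ) :
    Set (EuclideanSpace ℝ (Fin n)) :=
  {x | x ∈ Ω ∧ ∀ y ∈ Ω, f x ≤ f y}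

/-- Test functions touching `w` from above at `x`, with non-zero gradient at `x`. -/
def upperTests {n : ℕ} (Ω : Set (EuclideanSpace ℝ (Fin n))) (w : EuclideanSpace ℝ (Fin n) → ℝ)
    (x : EuclideanSpace ℝ (Fin n)) : Set (EuclideanSpace ℝ (Fin n) → ℝ) :=
  {φ | ContDiffOn ℝ 2 φ Ω ∧ x ∈ argmaxOn Ω (fun y => w y - φ y) ∧ gradient φ x ≠ 0}

/-- Test functions touching `w` from below at `x`, with non-zero gradient at `x`. -/
def lowerTests {n : ℕ} (Ω : Set (EuclideanSpace ℝ (Fin n))) (w : EuclideanSpace ℝ (Fin n) → ℝ)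
    (x : EuclideanSpace ℝ (Fin n)) : Set (EuclideanSpace ℝ (Fin n) → ℝ) :=
  {φ | ContDiffOn ℝ 2 φ Ω ∧ x ∈ argminOn Ω (fun y => w y - φ y) ∧ gradient φ x ≠ 0}

/-- `G(x, w, 𝔛 w, 𝔛𝔛⋆ w) ≤ 0` in `Ω` in the viscosity sense. -/
def IsViscositySubsolution {n m : ℕ}
    (G : EuclideanSpace ℝ (Fin n) → ℝ → (Fin m → ℝ) → Matrix (Fin m) (Fin m) ℝ → ℝ)
    (X : Fin m → EuclideanSpace ℝ (Fin n) → EuclideanSpace ℝ (Fin n))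
    (Ω : Set (EuclideanSpace ℝ (Fin n))) (w : EuclideanSpace ℝ (Fin n) → ℝ) : Prop :=
  UpperSemicontinuousOn w Ω ∧
    ∀ x ∈ Ω, ∀ φ ∈ upperTests Ω w x, G x (φ x) (subGrad X φ x) (subHess X φ x) ≤ 0

/-- `G(x, w, 𝔛 w, 𝔛𝔛⋆ w) ≥ 0` in `Ω` in the viscosity sense. -/
def IsViscositySupersolution {n m : ℕ}
    (G : EuclideanSpace ℝ (Fin n) → ℝ → (Fin m → ℝ) → Matrix (Fin m) (Fin m) ℝ → ℝ)
    (X : Fin m → EuclideanSpace ℝ (Fin n) → EuclideanSpace ℝ (Fin n))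
    (Ω : Set (EuclideanSpace ℝ (Fin n))) (w : EuclideanSpace ℝ (Fin n) → ℝ) : Prop :=
  LowerSemicontinuousOn w Ω ∧
    ∀ x ∈ Ω, ∀ φ ∈ lowerTests Ω w x, 0 ≤ G x (φ x) (subGrad X φ x) (subHess X φ x)

/-- The operator `𝓛 w = -Tr(A(𝔛 w) 𝔛𝔛⋆ w) + H(𝔛 w)`, as a function of `(x, w, 𝔛 w, 𝔛𝔛⋆ w)`. -/
def opL {n m : ℕ} (A : (Fin m → ℝ) → Matrix (Fin m) (Fin m) ℝ) (H : (Fin m → ℝ) → ℝ) :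
    EuclideanSpace ℝ (Fin n) → ℝ → (Fin m → ℝ) → Matrix (Fin m) (Fin m) ℝ → ℝ :=
  fun _ _ ξ M => -(A ξ * M).trace + H ξ

/-- `w + Λ|x|²/2` is convex for some `Λ > 0`. As `Ω` need not be convex, this means convexity
on every convex subset of `Ω` (on `Ω` itself if `Ω` is convex). -/
def IsSemiconvex {n : ℕ} (Ω : Set (EuclideanSpace ℝ (Fin n)))
    (w : EuclideanSpace ℝ (Fin n) → ℝ) : Prop :=
  ∃ Λ : ℝ, 0 < Λ ∧ ∀ s ⊆ Ω, Convex ℝ s → ConvexOn ℝ s (fun x => w x + 1 / 2 * Λ * ‖x‖ ^ 2)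

/-- `w` is semi-concave if `-w` is semi-convex. -/
def IsSemiconcave {n : ℕ} (Ω : Set (EuclideanSpace ℝ (Fin n)))
    (w : EuclideanSpace ℝ (Fin n) → ℝ) : Prop :=
  IsSemiconvex Ω (fun x => -w x)

end SubElliptic

end

/-!
Suppose `u > v` somewhere. Composing `u` with the increasing convex function
`s ↦ s + ε (s - s₀)² / 2` and using the scaling and ellipticity conditions turns `u` into a strict
subsolution wherever `𝔛u ≠ 0`. At a maximum point `y` of the perturbed difference both functions
are differentiable with a common gradient `p`, and second-order jets with ordered Hessians exist at
nearby points: Jensen's lemma produces contact points with paraboloids avoiding the null set where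
Alexandrov's second-order expansion fails. A strict subsolution cannot touch a supersolution this
way, hence `𝔛` applied to `p` vanishes at `y`. Letting `ε → 0`, the points `y` accumulate at a
maximum point of `u - v`, and gradients of semiconvex functions converge along contact points, so
`𝔛u` and `𝔛v` both vanish there, which is excluded.
-/

namespace SubElliptic

open Set Filter Topology MeasureTheory Metric Module Asymptotics
open scoped RealInnerProductSpace NNReal

theorem isLittleO_norm_sub_sq {F : Type*} [NormedAddCommGroup F] (x : F) :
    (fun z => ‖z - x‖ ^ 2) =o[𝓝 x] fun z => z - x := by
  have hlim : Tendsto (fun z => ‖z - x‖) (𝓝 x) (𝓝 0) := tendsto_norm_sub_self x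
  exact (by simpa [Function.comp_def] using
    (isLittleO_pow_id one_lt_two).comp_tendsto hlim : _ =o[𝓝 x] fun z => ‖z - x‖).of_norm_right

section Paraboloids

variable {E : Type*} [NormedAddCommGroup E] [InnerProductSpace ℝ E]
  {S : Set E} {f : E → ℝ} {C C' : ℝ} {x p x' p' : E}

/-- On `S`, the graph of `f` lies above a downward paraboloid with opening `C` and slope `p`, and
touches it at `x`. -/
def HasLowerParaboloid (S : Set E) (f : E → ℝ) (C : ℝ) (x p : E) : Prop :=
  ∀ z ∈ S, f x + ⟪p, z - x⟫ - C * ‖z - x‖ ^ 2 ≤ f z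

/-- On `S`, the graph of `f` lies below an upward paraboloid with opening `C` and slope `p`, and
touches it at `x`. -/
def HasUpperParaboloid (S : Set E) (f : E → ℝ) (C : ℝ) (x p : E) : Prop :=
  ∀ z ∈ S, f z ≤ f x + ⟪p, z - x⟫ + C * ‖z - x‖ ^ 2

theorem HasLowerParaboloid.mono (h : HasLowerParaboloid S f C x p) (hC : C ≤ C') :
    HasLowerParaboloid S f C' x p := fun z hz =>
  (sub_le_sub_left (by gcongr) _).trans (h z hz)

theorem HasUpperParaboloid.mono (h : HasUpperParaboloid S f C x p) (hC : C ≤ C') :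
    HasUpperParaboloid S f C' x p := fun z hz =>
  (h z hz).trans (by gcongr)

theorem exists_norm_le_inner_eq (p : E) {s : ℝ} (hs : 0 ≤ s) :
    ∃ e : E, ‖e‖ ≤ s ∧ ⟪p, e⟫ = s * ‖p‖ := by
  rcases eq_or_ne p 0 with rfl | hp
  · exact ⟨0, by simpa using hs, by simp⟩
  · have hp' : ‖p‖ ≠ 0 := norm_ne_zero_iff.2 hp
    refine ⟨(s / ‖p‖) • p, ?_, ?_⟩
    · rw [norm_smul, norm_div, norm_norm, Real.norm_of_nonneg hs, div_mul_cancel₀ _ hp']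
    · rw [inner_smul_right, real_inner_self_eq_norm_sq]
      field_simp

/-- Two paraboloids touching `f` from either side at `x` trap `f` to second order there, so any
paraboloid below `f` nearby has almost the same slope: test with `z = x' + e`, `e` in the
direction of `p' - p`. -/
theorem norm_slope_sub_le {s : ℝ} (hC : 0 ≤ C)
    (hup : HasUpperParaboloid S f C x p) (hlo : HasLowerParaboloid S f C x p)
    (hlo' : HasLowerParaboloid S f C x' p')
    (hs : 0 < s) (hxx' : ‖x' - x‖ ≤ s) (hball : closedBall x' s ⊆ S) :
    ‖p' - p‖ ≤ 6 * C * s := by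
  obtain ⟨e, he, hpe⟩ := exists_norm_le_inner_eq (p' - p) hs.le
  have hzS : x' + e ∈ S := hball (by simpa using he)
  have hsplit : ⟪p, x' + e - x⟫ = ⟪p, x' - x⟫ + ⟪p, e⟫ := by
    rw [← inner_add_right]; congr 1; abel
  have hnorm : ‖x' + e - x‖ ≤ 2 * s := by
    calc ‖x' + e - x‖ = ‖(x' - x) + e‖ := by congr 1; abel
      _ ≤ 2 * s := by linarith [norm_add_le (x' - x) e]
  have upper := hup _ hzS
  have lower := hlo x' (hball (mem_closedBall_self hs.le))
  have lower' := hlo' _ hzS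
  rw [add_sub_cancel_left] at lower'
  rw [inner_sub_left] at hpe
  have h₁ : C * ‖x' + e - x‖ ^ 2 ≤ C * (2 * s) ^ 2 := by gcongr
  have h₂ : C * ‖x' - x‖ ^ 2 ≤ C * s ^ 2 := by gcongr
  have h₃ : C * ‖e‖ ^ 2 ≤ C * s ^ 2 := by gcongr
  refine le_of_mul_le_mul_left (a := s) ?_ hs
  linarith

theorem norm_slope_sub_le_mul_norm_sub {r : ℝ} (hC : 0 ≤ C)
    (hup : HasUpperParaboloid S f C x p) (hlo : HasLowerParaboloid S f C x p)
    (hlo' : HasLowerParaboloid S f C x' p') (hr : ‖x' - x‖ < r) (hball : closedBall x' r ⊆ S) :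
    ‖p' - p‖ ≤ 6 * C * ‖x' - x‖ := by
  have hbound : ∀ᶠ s in 𝓝[>] ‖x' - x‖, ‖p' - p‖ ≤ 6 * C * s := by
    filter_upwards [Ioo_mem_nhdsGT hr] with s hs
    exact norm_slope_sub_le hC hup hlo hlo' ((norm_nonneg _).trans_lt hs.1) hs.1.le
      ((closedBall_subset_closedBall hs.2.le).trans hball)
  exact ge_of_tendsto (Continuous.tendsto (by fun_prop) _ |>.mono_left nhdsWithin_le_nhds) hbound

theorem eventually_norm_slope_sub_le (hC : 0 ≤ C) (hup : HasUpperParaboloid S f C x p)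
    (hlo : HasLowerParaboloid S f C x p) (hS : S ∈ 𝓝 x) :
    ∀ᶠ z in 𝓝 x, ∀ p', HasLowerParaboloid S f C z p' → ‖p' - p‖ ≤ 6 * C * ‖z - x‖ := by
  obtain ⟨ρ, hρ, hρS⟩ := nhds_basis_closedBall.mem_iff.1 hS
  filter_upwards [ball_mem_nhds x (half_pos hρ)] with z hz p' hp'
  rw [mem_ball_iff_norm] at hz
  refine norm_slope_sub_le_mul_norm_sub hC hup hlo hp' hz
    ((closedBall_subset_closedBall' ?_).trans hρS)
  rw [dist_eq_norm]
  linarith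

theorem tendsto_slope {ι : Type*} {l : Filter ι} {y slope : ι → E} (hC : 0 ≤ C)
    (hup : HasUpperParaboloid S f C x p) (hlo : HasLowerParaboloid S f C x p) (hS : S ∈ 𝓝 x)
    (hy : Tendsto y l (𝓝 x)) (hslope : ∀ᶠ i in l, HasLowerParaboloid S f C (y i) (slope i)) :
    Tendsto slope l (𝓝 p) := by
  refine tendsto_iff_norm_sub_tendsto_zero.2 (squeeze_zero' (.of_forall fun _ => norm_nonneg _)
    (g := fun i => 6 * C * ‖y i - x‖) ?_ ?_)
  · filter_upwards [hy.eventually (eventually_norm_slope_sub_le hC hup hlo hS), hslope]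
      with i hi hsi using hi _ hsi
  · simpa using (tendsto_iff_norm_sub_tendsto_zero.1 hy).const_mul (6 * C)

theorem HasUpperParaboloid.hasGradientAt [CompleteSpace E] (hup : HasUpperParaboloid S f C x p)
    (hlo : HasLowerParaboloid S f C' x p) (hS : S ∈ 𝓝 x) : HasGradientAt f p x := by
  rw [hasGradientAt_iff_isLittleO]
  refine IsBigO.trans_isLittleO (.of_bound (max C C') ?_) (isLittleO_norm_sub_sq x)
  filter_upwards [hS] with z hz
  have hup' := hup.mono (le_max_left C C') z hz
  have hlo' := hlo.mono (le_max_right C C') z hz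
  rw [Real.norm_eq_abs, norm_pow, norm_norm, abs_le]
  constructor <;> linarith

theorem HasUpperParaboloid.slope_eq (hup : HasUpperParaboloid S f C x p)
    (hlo : HasLowerParaboloid S f C' x p') (hS : S ∈ 𝓝 x) : p = p' := by
  have hmin : IsLocalMin (fun z => ⟪p - p', z - x⟫ + (C + C') * ‖z - x‖ ^ 2) x := by
    filter_upwards [hS] with z hz
    have := (hlo z hz).trans (hup z hz)
    simp only [sub_self, inner_zero_right, norm_zero, inner_sub_left]
    linarith
  have hsub : HasFDerivAt (fun z => z - x) (.id ℝ E) x := (hasFDerivAt_id x).sub_const x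
  have hderiv := (((innerSL ℝ (p - p')).hasFDerivAt.comp x hsub).add
    (hsub.norm_sq.const_mul (C + C')))
  have hzero (k : E) : ⟪p - p', k⟫ = 0 := by
    simpa [inner_sub_left] using congr($(hmin.hasFDerivAt_eq_zero hderiv) k)
  exact sub_eq_zero.1 (inner_self_eq_zero.1 (hzero _))

end Paraboloids

section Subgradients

variable {E : Type*} [NormedAddCommGroup E] [InnerProductSpace ℝ E]
  {S : Set E} {f : E → ℝ} {x x' q q' : E}

/-- `q` is a subgradient at `x` of the restriction of `f` to `S`. -/
def IsSubgradient (S : Set E) (f : E → ℝ) (x q : E) : Prop :=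
  ∀ z ∈ S, f x + ⟪q, z - x⟫ ≤ f z

theorem IsSubgradient.hasLowerParaboloid {C : ℝ} (h : IsSubgradient S f x q) (hC : 0 ≤ C) :
    HasLowerParaboloid S f C x q := fun z hz =>
  (sub_le_self _ (by positivity)).trans (h z hz)

theorem isSubgradient_of_mem_nhds {T : Set E} (hf : ConvexOn ℝ S f) (hx : x ∈ S) (hT : T ∈ 𝓝 x)
    (h : IsSubgradient T f x q) : IsSubgradient S f x q := by
  have hconv : ConvexOn ℝ S fun z => f z + -innerₗ E q z :=
    hf.add ((-innerₗ E q).convexOn hf.1)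
  have hmin : IsMinOn (fun z => f z + -innerₗ E q z) S x := by
    refine IsMinOn.of_isLocalMinOn_of_convexOn hx (IsLocalMin.on ?_ S) hconv
    filter_upwards [hT] with z hz
    have := h z hz
    simp only [innerₗ_apply_apply, inner_sub_right] at this ⊢
    linarith
  intro z hz
  have := hmin hz
  simp only [innerₗ_apply_apply, mem_ofPred_eq, inner_sub_right] at this ⊢
  linarith

theorem exists_clm_isSubgradient (hf : ConvexOn ℝ S f) (hS : IsOpen S) (hc : ContinuousOn f S)
    (hx : x ∈ S) : ∃ l : E →L[ℝ] ℝ, ∀ z ∈ S, f x + l (z - x) ≤ f z := by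
  have hopen : IsOpen {a : E × ℝ | a.1 ∈ S ∧ f a.1 < a.2} := by
    have hcont : ContinuousOn (fun a : E × ℝ => f a.1 - a.2) (S ×ˢ univ) :=
      (hc.comp continuousOn_fst fun a ha => ha.1).sub continuousOn_snd
    convert hcont.isOpen_inter_preimage (hS.prod isOpen_univ) (isOpen_Iio (a := (0 : ℝ))) using 1
    ext a
    simp
  obtain ⟨L, hL⟩ :=
    geometric_hahn_banach_open_point (x := (x, f x)) hf.convex_strict_epigraph hopen (by simp)
  have hL_apply (z : E) (t : ℝ) : L (z, t) = L (z, 0) + t * L (0, 1) := by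
    rw [← smul_eq_mul, ← map_smul, ← map_add]
    simp
  have hslope : L (0, 1) < 0 := by
    have := hL (x, f x + 1) ⟨hx, by simp⟩
    rw [hL_apply x (f x + 1), hL_apply x (f x)] at this
    linarith
  refine ⟨(-L (0, 1))⁻¹ • L.comp (.inl ℝ E ℝ), fun z hz => ?_⟩
  have hle : L (z, 0) + f z * L (0, 1) ≤ L (x, 0) + f x * L (0, 1) := by
    refine le_of_tendsto (Continuous.tendsto (f := fun t : ℝ => L (z, 0) + t * L (0, 1))
      (by fun_prop) (f z) |>.mono_left (nhdsWithin_le_nhds (s := Ioi (f z)))) ?_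
    filter_upwards [self_mem_nhdsWithin] with t ht
    rw [← hL_apply z t, ← hL_apply x (f x)]
    exact (hL (z, t) ⟨hz, ht⟩).le
  have hle' : (-L (0, 1))⁻¹ * (L (z, 0) - L (x, 0)) ≤ f z - f x := by
    rw [inv_mul_le_iff₀ (neg_pos.2 hslope)]
    linarith
  have : L (z - x, 0) = L (z, 0) - L (x, 0) := by rw [← map_sub]; simp
  simp only [smul_apply, ContinuousLinearMap.comp_apply, ContinuousLinearMap.inl_apply, this,
    smul_eq_mul]
  linarith

theorem exists_isSubgradient [CompleteSpace E] (hf : ConvexOn ℝ S f) (hc : ContinuousOn f S)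
    (hx : x ∈ interior S) : ∃ q, IsSubgradient S f x q := by
  obtain ⟨l, hl⟩ := exists_clm_isSubgradient (hf.subset interior_subset hf.1.interior)
    isOpen_interior (hc.mono interior_subset) hx
  refine ⟨(InnerProductSpace.toDual ℝ E).symm l, isSubgradient_of_mem_nhds hf
    (interior_subset hx) (isOpen_interior.mem_nhds hx) fun z hz => ?_⟩
  rw [InnerProductSpace.toDual_symm_apply]
  exact hl z hz

theorem IsSubgradient.norm_sub_le (h : IsSubgradient S f x q) (h' : IsSubgradient S f x' q')
    (hx : x ∈ S) (hx' : x' ∈ S) : ‖x - x'‖ ≤ ‖(x + q) - (x' + q')‖ := by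
  have hmono : 0 ≤ ⟪q - q', x - x'⟫ := by
    have h₁ := h x' hx'
    have h₂ := h' x hx
    rw [← neg_sub x x', inner_neg_right] at h₁
    rw [inner_sub_left]
    linarith
  have hsq : ‖x - x'‖ ^ 2 ≤ ‖(x + q) - (x' + q')‖ ^ 2 := by
    rw [add_sub_add_comm, norm_add_sq_real, real_inner_comm]
    nlinarith [sq_nonneg ‖q - q'‖]
  exact le_of_sq_le_sq hsq (norm_nonneg _)

theorem add_mul_norm_sq_le_of_isMinOn {m : ℝ} {z : E} (hf : StrongConvexOn S m f)
    (hmin : IsMinOn f S x) (hx : x ∈ S) (hz : z ∈ S) : f x + m / 2 * ‖x - z‖ ^ 2 ≤ f z := by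
  have hbound : ∀ᶠ t in 𝓝[>] (0 : ℝ), f x + (1 - t) * (m / 2 * ‖x - z‖ ^ 2) ≤ f z := by
    filter_upwards [Ioo_mem_nhdsGT one_pos] with t ht
    have hconv := hf.2 hx hz (sub_nonneg.2 ht.2.le) ht.1.le (by ring)
    have hle := hmin (hf.1 hx hz (sub_nonneg.2 ht.2.le) ht.1.le (by ring))
    simp only [mem_ofPred_eq, smul_eq_mul] at hconv hle
    refine le_of_mul_le_mul_left (a := t) ?_ ht.1
    linarith
  refine le_of_tendsto (Tendsto.mono_left ?_ nhdsWithin_le_nhds) hbound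
  exact Continuous.tendsto' (by fun_prop) _ _ (by ring)

/-- `J` is a selection of the proximal map `(id + ∂f)⁻¹` of the restriction of `f` to `S`. -/
def IsResolvent (S : Set E) (f : E → ℝ) (J : E → E) : Prop :=
  ∀ y, J y ∈ S ∧ IsSubgradient S f (J y) (y - J y)

theorem exists_isResolvent (hf : ConvexOn ℝ S f) (hS : IsCompact S) (hne : S.Nonempty)
    (hc : ContinuousOn f S) : ∃ J, IsResolvent S f J := by
  suffices ∀ y, ∃ x, x ∈ S ∧ IsSubgradient S f x (y - x) from Classical.axiom_of_choice this
  intro y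
  obtain ⟨x, hx, hmin⟩ := hS.exists_isMinOn hne
    (f := fun z => f z + 1 / 2 * ‖z - y‖ ^ 2) (hc.add (by fun_prop))
  have hstrong : StrongConvexOn S 1 fun z => f z + 1 / 2 * ‖z - y‖ ^ 2 := by
    rw [strongConvexOn_iff_convex]
    have haff : ConvexOn ℝ S fun z => -innerₗ E y z + 1 / 2 * ‖y‖ ^ 2 :=
      ((-innerₗ E y).convexOn hf.1).add_const _
    refine (hf.add haff).congr fun z _ => ?_
    simp only [Pi.add_apply, innerₗ_apply_apply, norm_sub_sq_real,
      real_inner_comm]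
    ring
  refine ⟨x, hx, fun z hz => ?_⟩
  have hgrowth := add_mul_norm_sq_le_of_isMinOn hstrong hmin hx hz
  have hexpand : ‖z - y‖ ^ 2 = ‖z - x‖ ^ 2 - 2 * ⟪y - x, z - x⟫ + ‖x - y‖ ^ 2 := by
    rw [← sub_sub_sub_cancel_right z y x, norm_sub_sq_real, real_inner_comm, norm_sub_rev y x]
  rw [norm_sub_rev x z] at hgrowth
  linarith

namespace IsResolvent

variable {J : E → E}

theorem lipschitzWith (hJ : IsResolvent S f J) : LipschitzWith 1 J :=
  LipschitzWith.of_dist_le_mul fun y y' => by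
    simpa [dist_eq_norm] using (hJ y).2.norm_sub_le (hJ y').2 (hJ y).1 (hJ y').1

theorem apply_add (hJ : IsResolvent S f J) (hx : x ∈ S) (h : IsSubgradient S f x q) :
    J (x + q) = x := by
  simpa [sub_eq_zero] using (hJ (x + q)).2.norm_sub_le h (hJ (x + q)).1 hx

/-- The Moreau envelope of `f`: both one-sided bounds come from the subgradient inequality, and
their gap is controlled by the continuity of `J`. -/
theorem hasGradientAt_envelope [CompleteSpace E] (hJ : IsResolvent S f J) (y : E) :
    HasGradientAt (fun y => f (J y) + 1 / 2 * ‖y - J y‖ ^ 2) (y - J y) y := by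
  have hlower (a b : E) : f (J a) + 1 / 2 * ‖a - J a‖ ^ 2 + ⟪a - J a, b - a⟫ ≤
      f (J b) + 1 / 2 * ‖b - J b‖ ^ 2 := by
    have hsub := (hJ a).2 (J b) (hJ b).1
    have hdecomp : b - J b = (a - J a) + ((b - a) - (J b - J a)) := by abel
    rw [hdecomp, norm_add_sq_real, inner_sub_right _ (b - a)]
    linarith [sq_nonneg ‖(b - a) - (J b - J a)‖]
  rw [hasGradientAt_iff_isLittleO]
  have hres : (fun y' => (y' - J y') - (y - J y)) =o[𝓝 y] fun _ => (1 : ℝ) := by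
    rw [isLittleO_one_iff]
    have : Continuous J := hJ.lipschitzWith.continuous
    exact Continuous.tendsto' (by fun_prop) _ _ (by simp)
  refine IsBigO.trans_isLittleO (g := fun y' => ‖(y' - J y') - (y - J y)‖ * ‖y' - y‖)
    (.of_bound 1 (.of_forall fun y' => ?_))
    (by simpa using hres.norm_left.mul_isBigO (isBigO_refl (fun y' => ‖y' - y‖) (𝓝 y)))
  have h₁ := hlower y y'
  have h₂ := hlower y' y
  have h₃ := real_inner_le_norm ((y' - J y') - (y - J y)) (y' - y)
  rw [← neg_sub y' y, inner_neg_right] at h₂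
  rw [inner_sub_left] at h₃
  rw [Real.norm_eq_abs, norm_mul, norm_norm, norm_norm, one_mul, abs_le]
  constructor <;> linarith [mul_nonneg (norm_nonneg ((y' - J y') - (y - J y)))
    (norm_nonneg (y' - y))]

end IsResolvent
end Subgradients

section SecondOrder

variable {E : Type*} [NormedAddCommGroup E] [InnerProductSpace ℝ E]
  {S : Set E} {f : E → ℝ} {x q : E}

/-- Second-order Taylor expansion of `f` at `x` in Peano's sense, with gradient `q` and symmetric
Hessian `B`; no derivative of `f` away from `x` is involved. -/
structure HasSecondOrderExpansion (f : E → ℝ) (q : E) (B : E →L[ℝ] E) (x : E) : Prop where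
  isSymmetric : B.IsSymmetric
  isLittleO : (fun z => f z - f x - ⟪q, z - x⟫ - 1 / 2 * ⟪B (z - x), z - x⟫)
    =o[𝓝 x] fun z => ‖z - x‖ ^ 2

theorem isSymmetric_of_hasFDerivAt_gradient [CompleteSpace E] {G : E → E} {B : E →L[ℝ] E}
    (hf : ∀ᶠ z in 𝓝 x, HasGradientAt f (G z) z) (hG : HasFDerivAt G B x) : B.IsSymmetric := by
  intro a b
  have := second_derivative_symmetric_of_eventually_of_real hf
    ((innerSL ℝ : E →L[ℝ] E →L[ℝ] ℝ).hasFDerivAt.comp x hG) a b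
  rw [ContinuousLinearMap.coe_coe, real_inner_comm (B b)]
  exact this

theorem hasGradientAt_half_quadratic [CompleteSpace E] {B : E →L[ℝ] E} (hB : B.IsSymmetric)
    (x z : E) : HasGradientAt (fun z => 1 / 2 * ⟪B (z - x), z - x⟫) (B (z - x)) z := by
  have hsub : HasFDerivAt (fun z => z - x) (.id ℝ E) z := (hasFDerivAt_id z).sub_const x
  refine (((B.hasFDerivAt.comp z hsub).inner ℝ hsub).const_mul (1 / 2)).congr_fderiv ?_
  ext k
  have : ⟪B k, z - x⟫ = ⟪B (z - x), k⟫ := by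
    rw [real_inner_comm, ← hB.apply_clm, real_inner_comm]
  simp [fderivInnerCLM_apply, -map_sub, this, ← two_mul]

theorem hasSecondOrderExpansion_of_hasGradientAt [CompleteSpace E] {G : E → E} {B : E →L[ℝ] E}
    (hf : ∀ᶠ z in 𝓝 x, HasGradientAt f (G z) z) (hG : HasFDerivAt G B x) :
    HasSecondOrderExpansion f (G x) B x := by
  have hB := isSymmetric_of_hasFDerivAt_gradient hf hG
  refine ⟨hB, isLittleO_iff.2 fun η hη => ?_⟩
  obtain ⟨r, hr, hball⟩ := Metric.eventually_nhds_iff_ball.1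
    (hf.and ((hasFDerivAt_iff_isLittleO.1 hG).def hη))
  filter_upwards [ball_mem_nhds x hr] with z hz
  set φ : E → ℝ := fun z => f z - ⟪G x, z⟫ - 1 / 2 * ⟪B (z - x), z - x⟫
  have hderiv : ∀ y ∈ ball x r, HasGradientAt φ (G y - G x - B (y - x)) y := fun y hy => by
    have := ((hball y hy).1.hasFDerivAt.sub (innerSL ℝ (G x)).hasFDerivAt).sub
      (hasGradientAt_half_quadratic hB x y).hasFDerivAt
    refine (hasGradientAt_iff_hasFDerivAt.2 (this.congr_fderiv ?_))
    ext k; simp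
  have hsub : closedBall x ‖z - x‖ ⊆ ball x r :=
    closedBall_subset_ball (by simpa [dist_eq_norm] using hz)
  have hmvt := (convex_closedBall x ‖z - x‖).norm_image_sub_le_of_norm_hasFDerivWithin_le
    (fun y hy => (hderiv y (hsub hy)).hasFDerivAt.hasFDerivWithinAt) (C := η * ‖z - x‖)
    (fun y hy => ?_) (mem_closedBall_self (norm_nonneg _)) (mem_closedBall_iff_norm.2 le_rfl)
  · have : φ z - φ x = f z - f x - ⟪G x, z - x⟫ - 1 / 2 * ⟪B (z - x), z - x⟫ := by
      simp only [φ, sub_self, inner_sub_right]; ring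
    rw [norm_pow, norm_norm, ← this, sq, ← mul_assoc]
    exact hmvt
  · rw [LinearIsometryEquiv.norm_map]
    exact (hball y (hsub hy)).2.trans (by gcongr; simpa [dist_eq_norm] using hy)

theorem injective_fderiv_of_isBigO_sub_rev {F G : Type*} [NormedAddCommGroup F]
    [NormedSpace ℝ F] [NormedAddCommGroup G] [NormedSpace ℝ G] {J : F → G} {D : F →L[ℝ] G} {y : F}
    (hJ : HasFDerivAt J D y) (hrev : (fun z => z - y) =O[𝓝 y] fun z => J z - J y) :
    Function.Injective D := by
  refine (injective_iff_map_eq_zero D).2 fun k hk => ?_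
  have hline : Tendsto (fun t : ℝ => y + t • k) (𝓝 0) (𝓝 y) :=
    Continuous.tendsto' (by fun_prop) _ _ (by simp)
  have hsmall : (fun t : ℝ => t • k) =o[𝓝 0] fun t : ℝ => t • k := by
    refine IsBigO.trans_isLittleO (g := fun t : ℝ => J (y + t • k) - J y) ?_ ?_
    · simpa [Function.comp_def] using hrev.comp_tendsto hline
    · simpa [Function.comp_def, hk] using hJ.isLittleO.comp_tendsto hline
  by_contra hk0
  refine isLittleO_irrefl ?_ hsmall
  exact ((eventually_mem_nhdsWithin (a := (0 : ℝ)) (s := {0}ᶜ)).frequently.filter_mono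
    nhdsWithin_le_nhds).mono fun t ht => smul_ne_zero ht hk0

theorem isLittleO_half_quadratic {α : Type*} {l : Filter α} {w k : α → E} (D : E →L[ℝ] E)
    (h : w =o[l] k) : (fun a => 1 / 2 * ⟪D (w a), w a⟫) =o[l] fun a => ‖k a‖ ^ 2 := by
  refine IsBigO.trans_isLittleO (.const_mul_left (.of_bound ‖D‖ (.of_forall fun a => ?_)) _)
    (h.norm_norm.pow two_pos)
  calc ‖⟪D (w a), w a⟫‖ ≤ ‖D (w a)‖ * ‖w a‖ := norm_inner_le_norm _ _
    _ ≤ ‖D‖ * ‖w a‖ * ‖w a‖ := by gcongr; exact D.le_opNorm _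
    _ = ‖D‖ * ‖‖w a‖ ^ 2‖ := by rw [norm_pow, norm_norm]; ring

theorem half_norm_sq_sub_eq_completed_square {D : E ≃L[ℝ] E}
    (hD : ((D : E →L[ℝ] E) : E →ₗ[ℝ] E).IsSymmetric) (q y k : E) :
    1 / 2 * ‖q + (y - k)‖ ^ 2 - 1 / 2 * ‖q‖ ^ 2 - ⟪q, y⟫ - 1 / 2 * ⟪y - D y, y⟫ =
      1 / 2 * ⟪D (y - D.symm k), y - D.symm k⟫ - ⟪q, k⟫ - 1 / 2 * ⟪D.symm k - k, k⟫ := by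
  have hcross : ⟪D y, D.symm k⟫ = ⟪y, k⟫ := by simpa using hD y (D.symm k)
  simp only [map_sub, D.apply_symm_apply, norm_add_sq_real, norm_sub_sq_real, inner_sub_left,
    inner_sub_right, hcross, real_inner_self_eq_norm_sq, real_inner_comm k]
  ring

theorem hasSecondOrderExpansion_of_isResolvent [CompleteSpace E] {J g : E → E} {D : E ≃L[ℝ] E}
    (hJ : IsResolvent S f J) (hD : HasFDerivAt J (D : E →L[ℝ] E) (x + q))
    (hg : HasFDerivAt g (D.symm : E →L[ℝ] E) x) (hgx : g x = x + q)
    (hJg : ∀ᶠ z in 𝓝 x, J (g z) = z) :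
    HasSecondOrderExpansion f q (D.symm - .id ℝ E) x := by
  have hJx : J (x + q) = x := hgx ▸ hJg.self_of_nhds
  have henv := hasSecondOrderExpansion_of_hasGradientAt
    (.of_forall hJ.hasGradientAt_envelope) ((hasFDerivAt_id (x + q)).sub hD)
  have hDsymm : ((D : E →L[ℝ] E) : E →ₗ[ℝ] E).IsSymmetric := by
    simpa using LinearMap.IsSymmetric.id.sub henv.isSymmetric
  have hDinv : ((D.symm : E →L[ℝ] E) : E →ₗ[ℝ] E).IsSymmetric :=
    LinearMap.IsSymmetric.toLinearMap_symm (T := D.toLinearEquiv) hDsymm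
  refine ⟨hDinv.sub .id, ?_⟩
  have henv' := (henv.isLittleO.comp_tendsto (hgx ▸ hg.continuousAt.tendsto)).trans_isBigO
    ((hgx ▸ hg.isBigO_sub).norm_norm.pow 2)
  have hquad := (isLittleO_half_quadratic (D : E →L[ℝ] E) hg.isLittleO)
  refine (henv'.sub hquad).congr' ?_ .rfl
  filter_upwards [hJg] with z hz
  have hsquare := half_norm_sq_sub_eq_completed_square hDsymm q (g z - (x + q)) (z - x)
  have hres : q + (g z - (x + q) - (z - x)) = g z - z := by abel
  simp only [Function.comp_apply, hz, hJx, hgx, hres, add_sub_cancel_left, sub_apply,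
    ContinuousLinearMap.id_apply, ContinuousLinearEquiv.coe_coe] at hsquare ⊢
  linarith

theorem IsSubgradient.eventually_norm_add_sub_le {C : ℝ} (hlo : IsSubgradient S f x q)
    (hC : 0 ≤ C) (hup : HasUpperParaboloid S f C x q) (hS : S ∈ 𝓝 x) :
    ∀ᶠ z in 𝓝 x, ∀ q', IsSubgradient S f z q' →
      ‖(z + q') - (x + q)‖ ≤ (1 + 6 * C) * ‖z - x‖ := by
  filter_upwards [eventually_norm_slope_sub_le hC hup (hlo.hasLowerParaboloid hC) hS]
    with z hz q' hq'
  have hslope := hz q' (hq'.hasLowerParaboloid hC)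
  rw [add_sub_add_comm]
  linarith [norm_add_le (z - x) (q' - q)]

theorem IsResolvent.injective_fderiv {J : E → E} {D : E →L[ℝ] E} {C : ℝ}
    (hJ : IsResolvent S f J) (hlo : IsSubgradient S f x q) (hC : 0 ≤ C)
    (hup : HasUpperParaboloid S f C x q) (hS : S ∈ 𝓝 x) (hD : HasFDerivAt J D (x + q)) :
    Function.Injective D := by
  have hJx : J (x + q) = x := hJ.apply_add (mem_of_mem_nhds hS) hlo
  refine injective_fderiv_of_isBigO_sub_rev hD (.of_bound (1 + 6 * C) ?_)
  have hJc : Tendsto J (𝓝 (x + q)) (𝓝 x) := by simpa only [hJx] using hD.continuousAt.tendsto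
  filter_upwards [hJc (hlo.eventually_norm_add_sub_le hC hup hS)] with y hy
  simpa [hJx] using hy _ (hJ y).2

theorem IsResolvent.exists_hasSecondOrderExpansion [FiniteDimensional ℝ E] {J : E → E} {C : ℝ}
    (hJ : IsResolvent S f J) (hf : ConvexOn ℝ S f) (hc : ContinuousOn f S)
    (hlo : IsSubgradient S f x q) (hC : 0 ≤ C) (hup : HasUpperParaboloid S f C x q)
    (hS : S ∈ 𝓝 x) (hd : DifferentiableAt ℝ J (x + q)) :
    ∃ B, HasSecondOrderExpansion f q B x := by
  have hinj := hJ.injective_fderiv hlo hC hup hS hd.hasFDerivAt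
  let D : E ≃L[ℝ] E :=
    (LinearEquiv.ofInjectiveEndo (fderiv ℝ J (x + q) : E →ₗ[ℝ] E) hinj).toContinuousLinearEquiv
  have hD : HasFDerivAt J (D : E →L[ℝ] E) (x + q) := hd.hasFDerivAt
  have hsub : ∀ᶠ z in 𝓝 x, ∃ q', IsSubgradient S f z q' := by
    filter_upwards [isOpen_interior.mem_nhds (mem_interior_iff_mem_nhds.2 hS)] with z hz
    exact exists_isSubgradient hf hc hz
  obtain ⟨G, hG⟩ := hsub.choice
  have hest : ∀ᶠ z in 𝓝 x, ‖(z + G z) - (x + q)‖ ≤ (1 + 6 * C) * ‖z - x‖ := by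
    filter_upwards [hlo.eventually_norm_add_sub_le hC hup hS, hG] with z hz hGz using hz _ hGz
  have hgx : x + G x = x + q := by simpa [sub_eq_zero] using hest.self_of_nhds
  have hg : ContinuousAt (fun z => z + G z) x := by
    refine tendsto_iff_norm_sub_tendsto_zero.2 (squeeze_zero' (.of_forall fun _ => norm_nonneg _)
      (by simpa only [hgx] using hest) ?_)
    simpa using (tendsto_norm_sub_self x).const_mul (1 + 6 * C)
  have hJg : ∀ᶠ z in 𝓝 x, J (z + G z) = z := by
    filter_upwards [hS, hG] with z hz hGz using hJ.apply_add hz hGz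
  have hg' := HasFDerivAt.of_local_left_inverse hg (f' := D) (by rwa [hgx]) hJg
  exact ⟨_, hasSecondOrderExpansion_of_isResolvent hJ hD hg' hgx hJg⟩

/-- Alexandrov's theorem, restricted to points at which a paraboloid touches from above: such a
point `x` with subgradient `q` is the value at `x + q` of the resolvent, so the exceptional set is
the image under the 1-Lipschitz resolvent of its null set of non-differentiability. -/
theorem exists_null_forall_hasSecondOrderExpansion [FiniteDimensional ℝ E] [MeasurableSpace E]
    [BorelSpace E] (hf : ConvexOn ℝ S f) (hS : IsCompact S) (hc : ContinuousOn f S) :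
    ∃ N : Set E, μH[finrank ℝ E] N = 0 ∧ ∀ x ∈ interior S, x ∉ N → ∀ q C, 0 ≤ C →
      IsSubgradient S f x q → HasUpperParaboloid S f C x q →
      ∃ B, HasSecondOrderExpansion f q B x := by
  rcases S.eq_empty_or_nonempty with rfl | hne
  · exact ⟨∅, by simp, by simp⟩
  obtain ⟨J, hJ⟩ := exists_isResolvent hf hS hne hc
  refine ⟨J '' {y | ¬ DifferentiableAt ℝ J y}, ?_, fun x hx hxN q C hC hlo hup => ?_⟩
  · have hnull : μH[finrank ℝ E] {y | ¬ DifferentiableAt ℝ J y} = 0 :=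
      ae_iff.1 hJ.lipschitzWith.ae_differentiableAt
    simpa [hnull] using hJ.lipschitzWith.hausdorffMeasure_image_le (Nat.cast_nonneg (finrank ℝ E))
      {y | ¬ DifferentiableAt ℝ J y}
  · have hd : DifferentiableAt ℝ J (x + q) := by
      by_contra h
      exact hxN ⟨x + q, h, hJ.apply_add (interior_subset hx) hlo⟩
    exact hJ.exists_hasSecondOrderExpansion hf hc hlo hC hup (mem_interior_iff_mem_nhds.1 hx) hd

end SecondOrder

section Contact

variable {E : Type*} [NormedAddCommGroup E] [InnerProductSpace ℝ E]
  {S : Set E} {f g : E → ℝ} {C C' : ℝ} {x x₀ p q P : E}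

theorem HasLowerParaboloid.add (hf : HasLowerParaboloid S f C x p)
    (hg : HasLowerParaboloid S g C' x q) :
    HasLowerParaboloid S (f + g) (C + C') x (p + q) := fun z hz => by
  have hfz := hf z hz
  have hgz := hg z hz
  simp only [Pi.add_apply, inner_add_left]
  linarith

theorem hasUpperParaboloid_left_of_add (hsum : HasUpperParaboloid S (f + g) C x P)
    (hg : HasLowerParaboloid S g C' x q) : HasUpperParaboloid S f (C + C') x (P - q) :=
  fun z hz => by
  have hsumz := hsum z hz
  have hgz := hg z hz
  simp only [Pi.add_apply, inner_sub_left] at hsumz ⊢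
  linarith

theorem hasUpperParaboloid_zero_of_isMaxOn (h : IsMaxOn f S x) :
    HasUpperParaboloid S f 0 x 0 := fun z hz => by
  simpa using h hz

theorem norm_sub_sq_sub_norm_sub_sq (x z y : E) :
    ‖z - y‖ ^ 2 - ‖x - y‖ ^ 2 = 2 * ⟪x - y, z - x⟫ + ‖z - x‖ ^ 2 := by
  rw [← sub_add_sub_cancel' x y z, norm_add_sq_real]
  ring

/-- The paraboloid of vertex `x₀` tilted by the slope `P` and slid down onto the graph of `f`. -/
theorem exists_hasUpperParaboloid_of_isMaxOn {κ : ℝ} (hS : IsCompact S) (hx₀ : x₀ ∈ S)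
    (hf : ContinuousOn f S) (hmax : IsMaxOn f S x₀) (P : E) :
    ∃ x ∈ S, κ * ‖x - x₀‖ ≤ ‖P‖ ∧
      HasUpperParaboloid S f κ x (P + (2 * κ) • (x - x₀)) := by
  obtain ⟨x, hxS, hx⟩ := hS.exists_isMaxOn ⟨x₀, hx₀⟩
    (f := fun z => f z - ⟪P, z⟫ - κ * ‖z - x₀‖ ^ 2) ((hf.sub (by fun_prop)).sub (by fun_prop))
  have hle (z : E) (hz : z ∈ S) :
      f z - ⟪P, z⟫ - κ * ‖z - x₀‖ ^ 2 ≤ f x - ⟪P, x⟫ - κ * ‖x - x₀‖ ^ 2 := hx hz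
  refine ⟨x, hxS, ?_, fun z hz => ?_⟩
  · rcases (norm_nonneg (x - x₀)).eq_or_lt with h0 | hpos
    · simp [← h0]
    have hx₀' := hle x₀ hx₀
    have hfx : f x ≤ f x₀ := hmax hxS
    have hCS := real_inner_le_norm P (x₀ - x)
    rw [inner_sub_right, norm_sub_rev] at hCS
    rw [sub_self, norm_zero] at hx₀'
    refine le_of_mul_le_mul_right ?_ hpos
    linarith
  · have hsq := norm_sub_sq_sub_norm_sub_sq x z x₀
    have hlez := hle z hz
    rw [inner_add_left, real_inner_smul_left, inner_sub_right P]
    linear_combination hlez + κ * hsq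

theorem lipschitzOnWith_slope {K : Set E} {slope : E → E} {r : ℝ} (hC : 0 ≤ C)
    (hup : ∀ x ∈ K, HasUpperParaboloid S f C x (slope x))
    (hlo : ∀ x ∈ K, HasLowerParaboloid S f C x (slope x))
    (hdist : ∀ x ∈ K, ∀ y ∈ K, ‖x - y‖ < r) (hball : ∀ x ∈ K, closedBall x r ⊆ S) :
    LipschitzOnWith (6 * C).toNNReal slope K := by
  refine LipschitzOnWith.of_dist_le_mul fun x hx y hy => ?_
  rw [dist_eq_norm, dist_eq_norm, Real.coe_toNNReal _ (by positivity)]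
  exact norm_slope_sub_le_mul_norm_sub hC (hup y hy) (hlo y hy) (hlo x hx) (hdist x hx y hy)
    (hball x hx)

theorem hausdorffMeasure_pos_of_ball_subset_image [FiniteDimensional ℝ E] [MeasurableSpace E]
    [BorelSpace E] {K : Set E} {Q : E → E} {L : ℝ≥0} {r : ℝ} (hr : 0 < r)
    (hQ : LipschitzOnWith L Q K) (hcover : ball 0 r ⊆ Q '' K) : 0 < μH[finrank ℝ E] K := by
  have himage := hQ.hausdorffMeasure_image_le (Nat.cast_nonneg (finrank ℝ E))
  have hpos := (measure_ball_pos μH[finrank ℝ E] (0 : E) hr).trans_le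
    ((measure_mono hcover).trans himage)
  exact pos_of_ne_zero fun h => by simp [h] at hpos

/-- Jensen's lemma. The map sending a contact point near `x₀` to the slope of its tilted paraboloid
is Lipschitz and covers a ball, so the contact points have positive measure. -/
theorem exists_hasUpperParaboloid_notMem [FiniteDimensional ℝ E] [MeasurableSpace E]
    [BorelSpace E] {κ : ℝ} {N U : Set E} (hκ : 0 < κ) (hS : IsCompact S) (hSx : S ∈ 𝓝 x₀)
    (hf : ContinuousOn f S) (hlo : ∀ x ∈ interior S, ∃ p, HasLowerParaboloid S f C x p)
    (hmax : IsMaxOn f S x₀) (hN : μH[finrank ℝ E] N = 0) (hU : U ∈ 𝓝 x₀) :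
    ∃ x ∈ U, x ∉ N ∧ ∃ p, HasUpperParaboloid S f κ x p := by
  obtain ⟨r, hr, hrSU⟩ := nhds_basis_closedBall.mem_iff.1 (inter_mem hSx hU)
  obtain ⟨ρ, hρ, rfl⟩ : ∃ ρ > 0, r = 4 * ρ := ⟨r / 4, by positivity, by ring⟩
  set K : Set E := {x | ‖x - x₀‖ ≤ ρ ∧ ∃ p, HasUpperParaboloid S f κ x p}
  by_contra! hcon
  have hKN : K ⊆ N := fun x hx => by
    by_contra hxN
    obtain ⟨p, hp⟩ := hx.2
    exact hcon x (hrSU (mem_closedBall_iff_norm.2 (by linarith [hx.1]))).2 hxN p hp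
  have hball (x : E) (hx : x ∈ K) : closedBall x (3 * ρ) ⊆ S :=
    (closedBall_subset_closedBall' (by rw [dist_eq_norm]; linarith [hx.1])).trans
      (hrSU.trans inter_subset_left)
  have hnhds (x : E) (hx : x ∈ K) : S ∈ 𝓝 x :=
    mem_of_superset (closedBall_mem_nhds x (by positivity)) (hball x hx)
  choose! slope hslope using fun x (hx : x ∈ K) => hx.2
  have hslope_lo (x : E) (hx : x ∈ K) : HasLowerParaboloid S f C x (slope x) := by
    obtain ⟨p, hp⟩ := hlo x (mem_interior_iff_mem_nhds.2 (hnhds x hx))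
    rwa [(hslope x hx).slope_eq hp (hnhds x hx)]
  have hlip : LipschitzOnWith _ slope K := lipschitzOnWith_slope (C := max C κ) (r := 3 * ρ)
    (le_max_of_le_right hκ.le) (fun x hx => (hslope x hx).mono (le_max_right _ _))
    (fun x hx => (hslope_lo x hx).mono (le_max_left _ _))
    (fun x hx y hy => by
      rw [← sub_sub_sub_cancel_right x y x₀]
      linarith [norm_sub_le (x - x₀) (y - x₀), hx.1, hy.1]) hball
  have htilt : LipschitzWith _ fun x => (2 * κ) • (x - x₀) :=
    (lipschitzWith_smul (2 * κ)).comp (LipschitzWith.id.sub (.const x₀))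
  refine (hausdorffMeasure_pos_of_ball_subset_image (mul_pos hκ hρ)
    (hlip.sub htilt.lipschitzOnWith) fun P hP => ?_).ne' (measure_mono_null hKN hN)
  obtain ⟨x, -, hle, hup⟩ :=
    exists_hasUpperParaboloid_of_isMaxOn (κ := κ) hS (mem_of_mem_nhds hSx) hf hmax P
  have hxK : x ∈ K :=
    ⟨le_of_mul_le_mul_left (hle.trans (mem_ball_zero_iff.1 hP).le) hκ, _, hup⟩
  refine ⟨x, hxK, ?_⟩
  simp only [hup.slope_eq (hslope_lo x hxK) (hnhds x hxK) ▸ add_sub_cancel_right P _]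

end Contact

section Semiconvexity

variable {E : Type*} [NormedAddCommGroup E] [InnerProductSpace ℝ E]
  {S : Set E} {f g : E → ℝ} {C Λ Λ' : ℝ} {x x₀ p q : E} {B D : E →L[ℝ] E}

theorem HasSecondOrderExpansion.add (hf : HasSecondOrderExpansion f p B x)
    (hg : HasSecondOrderExpansion g q D x) :
    HasSecondOrderExpansion (f + g) (p + q) (B + D) x := by
  refine ⟨hf.isSymmetric.add hg.isSymmetric, (hf.isLittleO.add hg.isLittleO).congr_left ?_⟩
  intro z
  simp only [Pi.add_apply, inner_add_left, add_apply]
  ring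

theorem HasSecondOrderExpansion.neg (hf : HasSecondOrderExpansion f p B x) :
    HasSecondOrderExpansion (-f) (-p) (-B) x := by
  refine ⟨fun a b => ?_, hf.isLittleO.neg_left.congr_left fun z => ?_⟩
  · exact (inner_neg_left _ _).trans
      ((congrArg Neg.neg (hf.isSymmetric a b)).trans (inner_neg_right _ _).symm)
  simp only [Pi.neg_apply, inner_neg_left, neg_apply]
  ring

theorem hasSecondOrderExpansion_mul_norm_sq (c : ℝ) (x : E) :
    HasSecondOrderExpansion (fun z => c / 2 * ‖z‖ ^ 2) (c • x) (c • .id ℝ E) x := by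
  refine ⟨LinearMap.IsSymmetric.id.smul (conj_trivial c), (isLittleO_zero _ _).congr_left ?_⟩
  intro z
  have hsq := norm_sub_sq_sub_norm_sub_sq x z 0
  simp only [sub_zero] at hsq
  simp only [smul_apply, ContinuousLinearMap.id_apply, real_inner_smul_left,
    real_inner_self_eq_norm_sq]
  linear_combination (-c / 2) * hsq

theorem HasSecondOrderExpansion.inner_le (hf : HasSecondOrderExpansion f p B x)
    (hup : HasUpperParaboloid S f C x p) (hS : S ∈ 𝓝 x) (e : E) :
    ⟪B e, e⟫ ≤ 2 * C * ‖e‖ ^ 2 := by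
  have hbound : ∀ η > 0, ⟪B e, e⟫ ≤ 2 * (C + η) * ‖e‖ ^ 2 := by
    intro η hη
    have hray : Tendsto (fun s : ℝ => x + s • e) (𝓝[>] 0) (𝓝 x) :=
      (Continuous.tendsto' (by fun_prop) _ _ (by simp)).mono_left nhdsWithin_le_nhds
    obtain ⟨s, hs, hsS, hspos⟩ :=
      ((hray.eventually (hf.isLittleO.def hη)).and
        ((hray.eventually hS).and self_mem_nhdsWithin)).exists
    have hupper := hup _ hsS
    rw [norm_pow, norm_norm] at hs
    have hlower := neg_le_of_abs_le hs
    simp only [add_sub_cancel_left, real_inner_smul_left, real_inner_smul_right, map_smul,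
      norm_smul, mul_pow, Real.norm_eq_abs, sq_abs] at hupper hlower
    refine le_of_mul_le_mul_left (a := s ^ 2) ?_ (pow_pos hspos 2)
    linarith
  have hlim : Tendsto (fun η => 2 * (C + η) * ‖e‖ ^ 2) (𝓝[>] 0) (𝓝 (2 * C * ‖e‖ ^ 2)) :=
    (Continuous.tendsto' (by fun_prop) _ _ (by simp)).mono_left nhdsWithin_le_nhds
  exact ge_of_tendsto hlim (eventually_mem_nhdsWithin.mono hbound)

theorem HasSecondOrderExpansion.le_inner (hf : HasSecondOrderExpansion f p B x)
    (hlo : HasLowerParaboloid S f C x p) (hS : S ∈ 𝓝 x) (e : E) :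
    -(2 * C * ‖e‖ ^ 2) ≤ ⟪B e, e⟫ := by
  have hup : HasUpperParaboloid S (-f) C x (-p) := fun z hz => by
    have := hlo z hz
    simp only [Pi.neg_apply, inner_neg_left]
    linarith
  have := hf.neg.inner_le hup hS e
  rw [neg_apply, inner_neg_left] at this
  linarith

theorem isSubgradient_add_mul_norm_sq_iff :
    IsSubgradient S (fun z => f z + Λ / 2 * ‖z‖ ^ 2) x (p + Λ • x) ↔
      HasLowerParaboloid S f (Λ / 2) x p := by
  refine forall₂_congr fun z _ => ?_
  have hsq := norm_sub_sq_sub_norm_sub_sq x z 0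
  simp only [sub_zero] at hsq
  rw [inner_add_left, real_inner_smul_left]
  constructor <;> intro h
  · linear_combination h + Λ / 2 * hsq
  · linear_combination h - Λ / 2 * hsq

theorem HasUpperParaboloid.add_mul_norm_sq (h : HasUpperParaboloid S f C x p) :
    HasUpperParaboloid S (fun z => f z + Λ / 2 * ‖z‖ ^ 2) (C + Λ / 2) x (p + Λ • x) :=
  fun z hz => by
  have hsq := norm_sub_sq_sub_norm_sub_sq x z 0
  simp only [sub_zero] at hsq
  rw [inner_add_left, real_inner_smul_left]
  linear_combination h z hz + Λ / 2 * hsq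

theorem strongConvexOn_neg_iff :
    StrongConvexOn S (-Λ) f ↔ ConvexOn ℝ S fun z => f z + Λ / 2 * ‖z‖ ^ 2 := by
  simp only [strongConvexOn_iff_convex, neg_div, neg_mul, sub_neg_eq_add]

theorem exists_hasLowerParaboloid [CompleteSpace E] (hf : StrongConvexOn S (-Λ) f)
    (hc : ContinuousOn f S) (hx : x ∈ interior S) :
    ∃ p, HasLowerParaboloid S f (Λ / 2) x p := by
  obtain ⟨q, hq⟩ := exists_isSubgradient (strongConvexOn_neg_iff.1 hf) (hc.add (by fun_prop)) hx
  exact ⟨q - Λ • x, isSubgradient_add_mul_norm_sq_iff.1 (by rwa [sub_add_cancel])⟩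

theorem exists_null_forall_hasSecondOrderExpansion_of_strongConvexOn [FiniteDimensional ℝ E]
    [MeasurableSpace E] [BorelSpace E] (hf : StrongConvexOn S (-Λ) f) (hS : IsCompact S)
    (hc : ContinuousOn f S) :
    ∃ N : Set E, μH[finrank ℝ E] N = 0 ∧ ∀ x ∈ interior S, x ∉ N → ∀ p C,
      HasLowerParaboloid S f (Λ / 2) x p → HasUpperParaboloid S f C x p →
      ∃ B, HasSecondOrderExpansion f p B x := by
  obtain ⟨N, hN, hexp⟩ := exists_null_forall_hasSecondOrderExpansion
    (strongConvexOn_neg_iff.1 hf) hS (hc.add (by fun_prop))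
  refine ⟨N, hN, fun x hx hxN p C hlo hup => ?_⟩
  obtain ⟨B, hB⟩ := hexp x hx hxN (p + Λ • x) _ (le_max_right (C + Λ / 2) 0)
    (isSubgradient_add_mul_norm_sq_iff.2 hlo) (hup.add_mul_norm_sq.mono (le_max_left _ _))
  refine ⟨B + -(Λ • .id ℝ E), ?_⟩
  convert hB.add (hasSecondOrderExpansion_mul_norm_sq Λ x).neg using 1
  · ext z
    simp
  · abel

end Semiconvexity

section Sums

variable {E : Type*} [NormedAddCommGroup E] [InnerProductSpace ℝ E]
  {S : Set E} {f g : E → ℝ} {Λ Λ' : ℝ} {x₀ : E}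

theorem hasUpperParaboloid_pair_of_add {C C' κ : ℝ} {x p q P : E}
    (hf : HasLowerParaboloid S f C x p) (hg : HasLowerParaboloid S g C' x q)
    (hsum : HasUpperParaboloid S (f + g) κ x P) (hS : S ∈ 𝓝 x) :
    P = p + q ∧ HasUpperParaboloid S f (κ + C') x p ∧ HasUpperParaboloid S g (κ + C) x q := by
  obtain rfl : P = p + q := hsum.slope_eq (hf.add hg) hS
  refine ⟨rfl, ?_, ?_⟩
  · simpa using hasUpperParaboloid_left_of_add hsum hg
  · rw [add_comm] at hsum
    simpa only [add_sub_cancel_left] using hasUpperParaboloid_left_of_add hsum hf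

theorem exists_hasLowerParaboloid_pair_of_isMaxOn [CompleteSpace E]
    (hf : StrongConvexOn S (-Λ) f) (hg : StrongConvexOn S (-Λ') g) (hfc : ContinuousOn f S)
    (hgc : ContinuousOn g S) (hS : S ∈ 𝓝 x₀) (hmax : IsMaxOn (f + g) S x₀) :
    ∃ p, HasLowerParaboloid S f (Λ / 2) x₀ p ∧ HasLowerParaboloid S g (Λ' / 2) x₀ (-p) := by
  obtain ⟨p, hp⟩ := exists_hasLowerParaboloid hf hfc (mem_interior_iff_mem_nhds.2 hS)
  obtain ⟨q, hq⟩ := exists_hasLowerParaboloid hg hgc (mem_interior_iff_mem_nhds.2 hS)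
  have hpq := (hasUpperParaboloid_pair_of_add hp hq
    (hasUpperParaboloid_zero_of_isMaxOn hmax) hS).1
  exact ⟨p, hp, neg_eq_of_add_eq_zero_right hpq.symm ▸ hq⟩

/-- At a point of contact between `f + g` and a paraboloid, semiconvexity of one summand turns
contact of the sum from above into contact of the other summand, so both are twice differentiable
there by Alexandrov's theorem. -/
theorem exists_hasSecondOrderExpansion_pair [FiniteDimensional ℝ E] {κ : ℝ} {U : Set E}
    (hκ : 0 < κ) (hf : StrongConvexOn S (-Λ) f) (hg : StrongConvexOn S (-Λ') g)
    (hfc : ContinuousOn f S) (hgc : ContinuousOn g S) (hScomp : IsCompact S) (hS : S ∈ 𝓝 x₀)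
    (hmax : IsMaxOn (f + g) S x₀) (hU : U ∈ 𝓝 x₀) :
    ∃ x ∈ U ∩ interior S, ∃ p q B D,
      HasLowerParaboloid S f (Λ / 2) x p ∧ HasLowerParaboloid S g (Λ' / 2) x q ∧
      HasSecondOrderExpansion f p B x ∧ HasSecondOrderExpansion g q D x ∧
      ∀ e, ⟪B e, e⟫ + ⟪D e, e⟫ ≤ 2 * κ * ‖e‖ ^ 2 := by
  borelize E
  obtain ⟨N, hN, hexpf⟩ :=
    exists_null_forall_hasSecondOrderExpansion_of_strongConvexOn hf hScomp hfc
  obtain ⟨N', hN', hexpg⟩ :=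
    exists_null_forall_hasSecondOrderExpansion_of_strongConvexOn hg hScomp hgc
  have hlo (x : E) (hx : x ∈ interior S) :
      ∃ p, HasLowerParaboloid S (f + g) (Λ / 2 + Λ' / 2) x p := by
    obtain ⟨p, hp⟩ := exists_hasLowerParaboloid hf hfc hx
    obtain ⟨q, hq⟩ := exists_hasLowerParaboloid hg hgc hx
    exact ⟨_, hp.add hq⟩
  obtain ⟨x, hx, hxN, P, hP⟩ := exists_hasUpperParaboloid_notMem hκ hScomp hS (hfc.add hgc) hlo
    hmax (measure_union_null hN hN')
    (inter_mem hU (isOpen_interior.mem_nhds (mem_interior_iff_mem_nhds.2 hS)))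
  have hSx : S ∈ 𝓝 x := mem_interior_iff_mem_nhds.1 hx.2
  obtain ⟨p, hp⟩ := exists_hasLowerParaboloid hf hfc hx.2
  obtain ⟨q, hq⟩ := exists_hasLowerParaboloid hg hgc hx.2
  obtain ⟨rfl, hfup, hgup⟩ := hasUpperParaboloid_pair_of_add hp hq hP hSx
  obtain ⟨B, hB⟩ := hexpf x hx.2 (fun h => hxN (.inl h)) p _ hp hfup
  obtain ⟨D, hD⟩ := hexpg x hx.2 (fun h => hxN (.inr h)) q _ hq hgup
  refine ⟨x, hx, p, q, B, D, hp, hq, hB, hD, fun e => ?_⟩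
  simpa only [add_apply, inner_add_left] using (hB.add hD).inner_le hP hSx e

/-- Limits of second-order expansions of `f`, as triples of base point, gradient and Hessian. -/
def limitingJets (f : E → ℝ) : Set (E × E × (E →L[ℝ] E)) :=
  closure {j | HasSecondOrderExpansion f j.2.1 j.2.2 j.1}

theorem norm_le_of_isSymmetric {B : E →L[ℝ] E} {c : ℝ} (hB : B.IsSymmetric) (hc : 0 ≤ c)
    (hle : ∀ e, |⟪B e, e⟫| ≤ c * ‖e‖ ^ 2) : ‖B‖ ≤ c := by
  rw [B.norm_eq_iSup_rayleighQuotient hB]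
  refine ciSup_le fun e => ?_
  rw [ContinuousLinearMap.rayleighQuotient, abs_div, abs_of_nonneg (sq_nonneg ‖e‖)]
  exact div_le_of_le_mul₀ (sq_nonneg _) hc (hle e)

theorem norm_hessian_le_of_add_le {κ : ℝ} {x p q : E} {B D : E →L[ℝ] E} (hΛ : 0 ≤ Λ)
    (hΛ' : 0 ≤ Λ') (hκ : 0 ≤ κ) (hS : S ∈ 𝓝 x) (hp : HasLowerParaboloid S f (Λ / 2) x p)
    (hq : HasLowerParaboloid S g (Λ' / 2) x q) (hB : HasSecondOrderExpansion f p B x)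
    (hD : HasSecondOrderExpansion g q D x)
    (hle : ∀ e, ⟪B e, e⟫ + ⟪D e, e⟫ ≤ 2 * κ * ‖e‖ ^ 2) : ‖B‖ ≤ Λ + Λ' + 2 * κ := by
  refine norm_le_of_isSymmetric hB.isSymmetric (by positivity) fun e => abs_le.2 ?_
  have hBe := hB.le_inner hp hS e
  have hDe := hD.le_inner hq hS e
  have hsum := hle e
  have : 0 ≤ Λ * ‖e‖ ^ 2 := by positivity
  have : 0 ≤ Λ' * ‖e‖ ^ 2 := by positivity
  have : 0 ≤ κ * ‖e‖ ^ 2 := by positivity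
  constructor <;> linarith

theorem exists_mem_limitingJets_of_tendsto [FiniteDimensional ℝ E] {y p q : ℕ → E} {κ : ℕ → ℝ}
    {B D : ℕ → E →L[ℝ] E} {p₀ q₀ : E} {c : ℝ} (hy : Tendsto y atTop (𝓝 x₀))
    (hp : Tendsto p atTop (𝓝 p₀)) (hq : Tendsto q atTop (𝓝 q₀)) (hκ : Tendsto κ atTop (𝓝 0))
    (hB : ∀ k, HasSecondOrderExpansion f (p k) (B k) (y k))
    (hD : ∀ k, HasSecondOrderExpansion g (q k) (D k) (y k))
    (hBc : ∀ k, ‖B k‖ ≤ c) (hDc : ∀ k, ‖D k‖ ≤ c)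
    (hle : ∀ k e, ⟪B k e, e⟫ + ⟪D k e, e⟫ ≤ 2 * κ k * ‖e‖ ^ 2) :
    ∃ B₀ D₀, (x₀, p₀, B₀) ∈ limitingJets f ∧ (x₀, q₀, D₀) ∈ limitingJets g ∧
      ∀ e, ⟪B₀ e, e⟫ + ⟪D₀ e, e⟫ ≤ 0 := by
  have := FiniteDimensional.proper ℝ (E →L[ℝ] E)
  obtain ⟨⟨B₀, D₀⟩, -, ψ, hψ, hlim⟩ :=
    ((isCompact_closedBall 0 c).prod (isCompact_closedBall 0 c)).tendsto_subseq
      (x := fun k => (B k, D k))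
      fun k => ⟨mem_closedBall_zero_iff.2 (hBc k), mem_closedBall_zero_iff.2 (hDc k)⟩
  have hB₀ : Tendsto (B ∘ ψ) atTop (𝓝 B₀) := (continuous_fst.tendsto _).comp hlim
  have hD₀ : Tendsto (D ∘ ψ) atTop (𝓝 D₀) := (continuous_snd.tendsto _).comp hlim
  have hψ' := hψ.tendsto_atTop
  refine ⟨B₀, D₀, ?_, ?_, fun e => ?_⟩
  · exact mem_closure_of_tendsto ((hy.comp hψ').prodMk_nhds ((hp.comp hψ').prodMk_nhds hB₀))
      (.of_forall fun k => hB (ψ k))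
  · exact mem_closure_of_tendsto ((hy.comp hψ').prodMk_nhds ((hq.comp hψ').prodMk_nhds hD₀))
      (.of_forall fun k => hD (ψ k))
  · have happ : Continuous fun T : E →L[ℝ] E => ⟪T e, e⟫ := by fun_prop
    refine le_of_tendsto_of_tendsto' (((happ.tendsto _).comp hB₀).add
      ((happ.tendsto _).comp hD₀)) ?_ fun k => hle (ψ k) e
    simpa only [mul_zero, zero_mul, Function.comp_def] using
      ((hκ.comp hψ').const_mul 2).mul_const (‖e‖ ^ 2)

/-- Theorem on sums for semiconvex functions. -/
theorem exists_mem_limitingJets_of_isMaxOn [FiniteDimensional ℝ E] {p : E} (hΛ : 0 ≤ Λ)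
    (hΛ' : 0 ≤ Λ') (hf : StrongConvexOn S (-Λ) f) (hg : StrongConvexOn S (-Λ') g)
    (hfc : ContinuousOn f S) (hgc : ContinuousOn g S) (hScomp : IsCompact S) (hS : S ∈ 𝓝 x₀)
    (hmax : IsMaxOn (f + g) S x₀) (hp : HasLowerParaboloid S f (Λ / 2) x₀ p)
    (hq : HasLowerParaboloid S g (Λ' / 2) x₀ (-p)) :
    ∃ B D, (x₀, p, B) ∈ limitingJets f ∧ (x₀, -p, D) ∈ limitingJets g ∧
      ∀ e, ⟪B e, e⟫ + ⟪D e, e⟫ ≤ 0 := by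
  have hκ (k : ℕ) : (0 : ℝ) < 1 / (k + 1) := Nat.one_div_pos_of_nat
  choose y hyU pf pg Bf Bg hpf hpg hBf hBg hle using fun k : ℕ =>
    exists_hasSecondOrderExpansion_pair (hκ k) hf hg hfc hgc hScomp hS hmax
      (ball_mem_nhds x₀ (hκ k))
  have hySk (k : ℕ) : S ∈ 𝓝 (y k) := mem_interior_iff_mem_nhds.1 (hyU k).2
  have hκ0 : Tendsto (fun k : ℕ => (1 : ℝ) / (k + 1)) atTop (𝓝 0) :=
    tendsto_one_div_add_atTop_nhds_zero_nat
  have hy : Tendsto y atTop (𝓝 x₀) :=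
    tendsto_iff_dist_tendsto_zero.2 (squeeze_zero (fun _ => dist_nonneg)
      (fun k => (mem_ball.1 (hyU k).1).le) hκ0)
  obtain ⟨-, hfup, hgup⟩ := hasUpperParaboloid_pair_of_add hp hq
    (hasUpperParaboloid_zero_of_isMaxOn hmax) hS
  have hpf_lim : Tendsto pf atTop (𝓝 p) := tendsto_slope (C := Λ / 2 + Λ' / 2) (by positivity)
    (hfup.mono (by linarith)) (hp.mono (by linarith)) hS hy
    (.of_forall fun k => (hpf k).mono (by linarith))
  have hpg_lim : Tendsto pg atTop (𝓝 (-p)) := tendsto_slope (C := Λ / 2 + Λ' / 2) (by positivity)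
    (hgup.mono (by linarith)) (hq.mono (by linarith)) hS hy
    (.of_forall fun k => (hpg k).mono (by linarith))
  have hκ1 (k : ℕ) : (1 : ℝ) / (k + 1) ≤ 1 := by
    rw [div_le_one (by positivity)]
    linarith [k.cast_nonneg (α := ℝ)]
  refine exists_mem_limitingJets_of_tendsto (c := Λ + Λ' + 2) hy hpf_lim hpg_lim hκ0 hBf hBg
    (fun k => ?_) (fun k => ?_) hle
  · linarith [hκ1 k, norm_hessian_le_of_add_le hΛ hΛ' (hκ k).le (hySk k) (hpf k) (hpg k) (hBf k)
      (hBg k) (hle k)]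
  · linarith [hκ1 k, norm_hessian_le_of_add_le hΛ' hΛ (hκ k).le (hySk k) (hpg k) (hpf k) (hBg k)
      (hBf k) fun e => (add_comm _ _).trans_le (hle k e)]

end Sums

theorem HasSecondOrderExpansion.isLittleO_comp {Y : Type*} [TopologicalSpace Y] {f : Y → ℝ} {x : Y}
    {φ : ℝ → ℝ} {a b : ℝ}
    (hφ : HasSecondOrderExpansion φ a (b • .id ℝ ℝ) (f x)) (hfc : ContinuousAt f x) :
    (fun z => φ (f z) - φ (f x) - a * (f z - f x) - b / 2 * (f z - f x) ^ 2)
      =o[𝓝 x] fun z => (f z - f x) ^ 2 := by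
  refine (hφ.isLittleO.comp_tendsto hfc).congr (fun z => ?_) fun z => ?_
  · simp only [Function.comp_apply, smul_apply, ContinuousLinearMap.id_apply, smul_eq_mul,
      RCLike.inner_apply, conj_trivial]
    ring
  · simp

section Composition

variable {E : Type*} [NormedAddCommGroup E] [InnerProductSpace ℝ E]
  {S : Set E} {f : E → ℝ} {Λ : ℝ} {x p : E} {B : E →L[ℝ] E}

theorem strongConvexOn_comp {I : Set ℝ} {φ : ℝ → ℝ} {L : ℝ≥0} (hφ : ConvexOn ℝ I φ)
    (hmono : MonotoneOn φ I) (hL : LipschitzOnWith L φ I) (hΛ : 0 ≤ Λ)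
    (hf : StrongConvexOn S (-Λ) f) (hfI : MapsTo f S I) :
    StrongConvexOn S (-(L * Λ)) fun z => φ (f z) := by
  refine ⟨hf.1, fun x hx y hy a b ha hb hab => ?_⟩
  have hwI := hfI (hf.1 hx hy ha hb hab)
  have hmI := hφ.1 (hfI hx) (hfI hy) ha hb hab
  have hconvex := hφ.2 (hfI hx) (hfI hy) ha hb hab
  have hsemi := hf.2 hx hy ha hb hab
  set w := f (a • x + b • y)
  set m := a • f x + b • f y
  have hL0 : 0 ≤ L * (a * b * (Λ / 2 * ‖x - y‖ ^ 2)) := by positivity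
  have hφw : φ w ≤ φ m + L * (a * b * (Λ / 2 * ‖x - y‖ ^ 2)) := by
    rcases le_total w m with hwm | hmw
    · linarith [hmono hwI hmI hwm]
    · have hlip := (le_abs_self _).trans (hL.dist_le_mul w hwI m hmI)
      rw [Real.dist_eq, abs_of_nonneg (sub_nonneg.2 hmw)] at hlip
      have : L * (w - m) ≤ L * (a * b * (Λ / 2 * ‖x - y‖ ^ 2)) := by
        gcongr
        linarith
      linarith
  linarith

theorem HasSecondOrderExpansion.isBigO_sub_inner (hf : HasSecondOrderExpansion f p B x) :
    (fun z => f z - f x - ⟪p, z - x⟫) =O[𝓝 x] fun z => ‖z - x‖ ^ 2 := by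
  have hquad : (fun z => 1 / 2 * ⟪B (z - x), z - x⟫) =O[𝓝 x] fun z => ‖z - x‖ ^ 2 := by
    refine (IsBigO.of_bound ‖B‖ (.of_forall fun z => ?_)).const_mul_left (1 / 2)
    calc ‖⟪B (z - x), z - x⟫‖ ≤ ‖B (z - x)‖ * ‖z - x‖ := norm_inner_le_norm _ _
      _ ≤ ‖B‖ * ‖z - x‖ * ‖z - x‖ := by gcongr; exact B.le_opNorm _
      _ = ‖B‖ * ‖‖z - x‖ ^ 2‖ := by rw [norm_pow, norm_norm]; ring
  exact (hf.isLittleO.isBigO.add hquad).congr_left fun z => by ring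

theorem HasSecondOrderExpansion.isBigO_sub (hf : HasSecondOrderExpansion f p B x) :
    (fun z => f z - f x) =O[𝓝 x] fun z => ‖z - x‖ := by
  have hlin : (fun z => ⟪p, z - x⟫) =O[𝓝 x] fun z => ‖z - x‖ :=
    ((innerSL ℝ p).isBigO_comp _ _).norm_right
  refine ((hf.isBigO_sub_inner.trans ?_).add hlin).congr_left fun z => by ring
  exact (isLittleO_norm_sub_sq x).isBigO.norm_right

theorem HasSecondOrderExpansion.isBigO_sub_inner_of_comp {φ : ℝ → ℝ} {a b : ℝ} (ha : a ≠ 0)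
    (hφ : HasSecondOrderExpansion φ a (b • .id ℝ ℝ) (f x)) (hfc : ContinuousAt f x)
    (hf : HasSecondOrderExpansion (fun z => φ (f z)) p B x) :
    (fun z => f z - f x - a⁻¹ * ⟪p, z - x⟫) =O[𝓝 x] fun z => ‖z - x‖ ^ 2 := by
  have hinv : (fun z => f z - f x - a⁻¹ * (φ (f z) - φ (f x))) =O[𝓝 x]
      fun z => (f z - f x) ^ 2 := by
    have hsq : (fun z => b / 2 * (f z - f x) ^ 2) =O[𝓝 x] fun z => (f z - f x) ^ 2 :=
      (isBigO_refl _ _).const_mul_left _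
    refine (((hφ.isLittleO_comp hfc).isBigO.add hsq).const_mul_left (-a⁻¹)).congr_left fun z => ?_
    field_simp
    ring
  have hsmall : (fun z => (f z - f x) ^ 2) =o[𝓝 x] fun z => f z - f x := by
    simpa [Function.comp_def] using (isLittleO_norm_sub_sq (f x)).comp_tendsto hfc
  have hlip : (fun z => f z - f x) =O[𝓝 x] fun z => ‖z - x‖ := by
    have := (hinv.trans_isLittleO hsmall).right_isBigO_sub
    simp only [sub_sub_cancel] at this
    exact this.trans (hf.isBigO_sub.const_mul_left a⁻¹)
  exact ((hinv.trans (hlip.pow 2)).add (hf.isBigO_sub_inner.const_mul_left a⁻¹)).congr_left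
    fun z => by ring

/-- With `h = f z - f x`, the expansion of `φ ∘ f` reads
`a h + b h² / 2 + o(h²) = ⟪p, z - x⟫ + ⟪B (z - x), z - x⟫ / 2 + o(‖z - x‖²)`; solve for `h`. -/
theorem HasSecondOrderExpansion.of_comp {φ : ℝ → ℝ} {a b : ℝ} (ha : a ≠ 0)
    (hφ : HasSecondOrderExpansion φ a (b • .id ℝ ℝ) (f x)) (hfc : ContinuousAt f x)
    (hf : HasSecondOrderExpansion (fun z => φ (f z)) p B x) :
    HasSecondOrderExpansion f (a⁻¹ • p)
      (a⁻¹ • (B - b • InnerProductSpace.rankOne ℝ (a⁻¹ • p) (a⁻¹ • p))) x := by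
  have hfirst := hφ.isBigO_sub_inner_of_comp ha hfc hf
  have hinner : (fun z => a⁻¹ * ⟪p, z - x⟫) =O[𝓝 x] fun z => ‖z - x‖ :=
    ((innerSL ℝ p).isBigO_comp _ _).norm_right.const_mul_left _
  have hlip : (fun z => f z - f x) =O[𝓝 x] fun z => ‖z - x‖ :=
    ((hfirst.trans (isLittleO_norm_sub_sq x).isBigO.norm_right).add hinner).congr_left
      fun z => by ring
  have hcube : (fun z => ‖z - x‖ ^ 2 * ‖z - x‖) =o[𝓝 x] fun z => ‖z - x‖ ^ 2 := by
    have hone : (fun z => ‖z - x‖) =o[𝓝 x] fun _ => (1 : ℝ) :=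
      (isLittleO_one_iff ℝ).2 (tendsto_norm_sub_self x)
    simpa using (isBigO_refl (fun z => ‖z - x‖ ^ 2) (𝓝 x)).mul_isLittleO hone
  have hsq : (fun z => (f z - f x) ^ 2 - (a⁻¹ * ⟪p, z - x⟫) ^ 2) =o[𝓝 x]
      fun z => ‖z - x‖ ^ 2 :=
    ((hfirst.mul (hlip.add hinner)).trans_isLittleO hcube).congr_left fun z => by ring
  have hrem := (hφ.isLittleO_comp hfc).trans_isBigO (hlip.pow 2)
  refine ⟨?_, ?_⟩
  · have := InnerProductSpace.isSymmetric_rankOne_self (𝕜 := ℝ) (a⁻¹ • p)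
    exact (hf.isSymmetric.sub (this.smul (conj_trivial b))).smul (conj_trivial a⁻¹)
  · refine (((hf.isLittleO.sub hrem).sub (hsq.const_mul_left (b / 2))).const_mul_left
      a⁻¹).congr_left fun z => ?_
    simp only [smul_apply, sub_apply, InnerProductSpace.rankOne_apply, inner_sub_left,
      real_inner_smul_left]
    field_simp
    ring

end Composition

section Convexify

/-- The convex increasing change of the dependent variable which makes subsolutions strict. -/
noncomputable def convexify (ε s₀ s : ℝ) : ℝ := s + ε / 2 * (s - s₀) ^ 2

variable {ε s₀ : ℝ}

theorem continuous_convexify : Continuous (convexify ε s₀) := by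
  unfold convexify
  fun_prop

theorem convexOn_convexify (hε : 0 ≤ ε) : ConvexOn ℝ univ (convexify ε s₀) := by
  refine ⟨convex_univ, fun s _ t _ a b ha hb hab => ?_⟩
  obtain rfl : a = 1 - b := by linarith
  simp only [convexify, smul_eq_mul]
  have : 0 ≤ ε / 2 * ((1 - b) * b * (s - t) ^ 2) := by positivity
  linear_combination this

theorem monotoneOn_convexify (hε : 0 ≤ ε) : MonotoneOn (convexify ε s₀) (Ici s₀) := by
  intro s hs t _ hst
  have hs₀ : 0 ≤ s - s₀ := sub_nonneg.2 hs
  unfold convexify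
  gcongr

theorem lipschitzOnWith_convexify (hε : 0 ≤ ε) {K : ℝ≥0} {s₁ : ℝ} (hK : 1 + ε * (s₁ - s₀) ≤ K) :
    LipschitzOnWith K (convexify ε s₀) (Icc s₀ s₁) := by
  refine LipschitzOnWith.of_dist_le_mul fun s hs t ht => ?_
  have hfactor : convexify ε s₀ s - convexify ε s₀ t =
      (1 + ε * ((s - s₀) + (t - s₀)) / 2) * (s - t) := by
    unfold convexify
    ring
  have hs' := sub_nonneg.2 hs.1
  have ht' := sub_nonneg.2 ht.1
  rw [Real.dist_eq, Real.dist_eq, hfactor, abs_mul, abs_of_nonneg (by positivity)]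
  gcongr
  linarith [mul_le_mul_of_nonneg_left hs.2 hε, mul_le_mul_of_nonneg_left ht.2 hε]

theorem hasSecondOrderExpansion_convexify (s : ℝ) :
    HasSecondOrderExpansion (convexify ε s₀) (1 + ε * (s - s₀)) (ε • .id ℝ ℝ) s := by
  refine ⟨LinearMap.IsSymmetric.id.smul (conj_trivial ε), (isLittleO_zero _ _).congr_left ?_⟩
  intro t
  simp only [convexify, RCLike.inner_apply, Real.ringHom_apply, one_div, smul_apply,
    ContinuousLinearMap.id_apply, smul_eq_mul]
  ring

variable {E : Type*} [NormedAddCommGroup E] [InnerProductSpace ℝ E] {S : Set E} {u : E → ℝ}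

theorem exists_strongConvexOn_convexify {Λ s₁ : ℝ} (hε : 0 ≤ ε) (hΛ : 0 ≤ Λ)
    (hu : StrongConvexOn S (-Λ) u) (huI : MapsTo u S (Icc s₀ s₁)) :
    ∃ Λ' ≥ 0, StrongConvexOn S (-Λ') fun z => convexify ε s₀ (u z) :=
  ⟨(1 + ε * (s₁ - s₀)).toNNReal * Λ, by positivity,
    strongConvexOn_comp ((convexOn_convexify hε).subset (subset_univ _) (convex_Icc s₀ s₁))
      ((monotoneOn_convexify hε).mono Icc_subset_Ici_self)
      (lipschitzOnWith_convexify hε (Real.le_coe_toNNReal _)) hΛ hu huI⟩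

theorem mem_limitingJets_of_convexify {x₀ p : E} {B : E →L[ℝ] E}
    (hu : ∀ᶠ x in 𝓝 x₀, ContinuousAt u x) {t : ℝ} (ht : t = 1 + ε * (u x₀ - s₀)) (ht0 : t ≠ 0)
    (hj : (x₀, p, B) ∈ limitingJets fun z => convexify ε s₀ (u z)) :
    (x₀, t⁻¹ • p, t⁻¹ • (B - ε • InnerProductSpace.rankOne ℝ (t⁻¹ • p) (t⁻¹ • p)))
      ∈ limitingJets u := by
  subst ht
  let τ (x : E) : ℝ := 1 + ε * (u x - s₀)
  have hτ (x : E) (hx : ContinuousAt u x) : ContinuousAt τ x :=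
    ((hx.sub_const s₀).const_mul ε).const_add 1
  let F (j : E × E × (E →L[ℝ] E)) : E × E × (E →L[ℝ] E) :=
    (j.1, (τ j.1)⁻¹ • j.2.1, (τ j.1)⁻¹ •
      (j.2.2 - ε • InnerProductSpace.rankOne ℝ ((τ j.1)⁻¹ • j.2.1) ((τ j.1)⁻¹ • j.2.1)))
  have hFc : ContinuousAt F (x₀, p, B) := by
    have hinv : ContinuousAt (fun j : E × E × (E →L[ℝ] E) => (τ j.1)⁻¹) (x₀, p, B) :=
      ContinuousAt.comp (g := fun x => (τ x)⁻¹) (f := Prod.fst)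
        ((hτ x₀ hu.self_of_nhds).inv₀ ht0) continuousAt_fst
    have hslope : ContinuousAt (fun j : E × E × (E →L[ℝ] E) => (τ j.1)⁻¹ • j.2.1) (x₀, p, B) := by
      fun_prop
    have hrank : ContinuousAt (fun j : E × E × (E →L[ℝ] E) =>
        InnerProductSpace.rankOne ℝ ((τ j.1)⁻¹ • j.2.1) ((τ j.1)⁻¹ • j.2.1)) (x₀, p, B) :=
      ((InnerProductSpace.rankOne ℝ).continuous.continuousAt.comp hslope).clm_apply hslope
    exact continuousAt_fst.prodMk (hslope.prodMk (hinv.smul (by fun_prop)))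
  have hgood : ∀ᶠ x in 𝓝 x₀, ContinuousAt u x ∧ τ x ≠ 0 :=
    hu.and ((hτ x₀ hu.self_of_nhds).eventually_ne ht0)
  have hfreq := (mem_closure_iff_frequently.1 hj).and_eventually
    (continuousAt_fst.eventually hgood)
  refine mem_closure_iff_frequently.2 (hFc.tendsto.frequently (hfreq.mono fun j hj => ?_))
  exact (hasSecondOrderExpansion_convexify (u j.1)).of_comp hj.2.2 hj.2.1 hj.1

end Convexify

section TestFunctions

variable {E : Type*} [NormedAddCommGroup E] [InnerProductSpace ℝ E] {x p : E} {B : E →L[ℝ] E}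

/-- The polynomial with gradient `p` and Hessian `B` at `x`. The quartic term does not affect the
jet at `x` and serves to dominate bounded functions away from `x`. -/
noncomputable def testPoly (x p : E) (B : E →L[ℝ] E) (c : ℝ) (z : E) : ℝ :=
  ⟪p, z - x⟫ + 1 / 2 * ⟪B (z - x), z - x⟫ + c * (‖z - x‖ ^ 2) ^ 2

theorem contDiff_testPoly (c : ℝ) : ContDiff ℝ 2 (testPoly x p B c) := by
  have hsub : ContDiff ℝ 2 fun z : E => z - x := by fun_prop
  exact ((contDiff_const.inner ℝ hsub).add (contDiff_const.mul
    ((B.contDiff.comp hsub).inner ℝ hsub))).add (contDiff_const.mul ((hsub.norm_sq ℝ).pow 2))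

theorem hasGradientAt_testPoly [CompleteSpace E] (hB : B.IsSymmetric) (c : ℝ) (z : E) :
    HasGradientAt (testPoly x p B c)
      (p + B (z - x) + (4 * c * ‖z - x‖ ^ 2) • (z - x)) z := by
  have hsub : HasFDerivAt (fun z : E => z - x) (.id ℝ E) z := (hasFDerivAt_id z).sub_const x
  have hlin := (hasFDerivAt_const p z).inner ℝ hsub
  have hquad := (B.hasFDerivAt.comp z hsub).inner ℝ hsub
  refine hasGradientAt_iff_hasFDerivAt.2 (((hlin.add (hquad.const_mul (1 / 2))).add
    ((hsub.norm_sq.pow 2).const_mul c)).congr_fderiv ?_)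
  ext k
  have hBk : ⟪B k, z - x⟫ = ⟪B (z - x), k⟫ := (hB k (z - x)).trans (real_inner_comm _ _)
  simp only [map_sub, inner_sub_left, inner_sub_right] at hBk
  simp only [one_div, Function.comp_apply, map_sub, ContinuousLinearMap.comp_id,
    Nat.add_one_sub_one, pow_one, nsmul_eq_mul, Nat.cast_ofNat, add_apply,
    ContinuousLinearMap.comp_apply, ContinuousLinearMap.prod_apply, zero_apply,
    ContinuousLinearMap.id_apply, fderivInnerCLM_apply, inner_sub_right, inner_zero_left, sub_self,
    add_zero, smul_apply, inner_sub_left, smul_eq_mul, sub_apply, coe_innerSL_apply, map_add,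
    map_smul, InnerProductSpace.toDual_apply_apply]
  linear_combination (1 / 2) * hBk

theorem hasFDerivAt_gradient_testPoly (c : ℝ) :
    HasFDerivAt (fun z => p + B (z - x) + (4 * c * ‖z - x‖ ^ 2) • (z - x)) B x := by
  have hsub : HasFDerivAt (fun z : E => z - x) (.id ℝ E) x := (hasFDerivAt_id x).sub_const x
  refine (((B.hasFDerivAt.comp x hsub).const_add p).add
    ((hsub.norm_sq.const_mul (4 * c)).smul hsub)).congr_fderiv ?_
  ext k
  simp

theorem exists_forall_norm_ge_le_testPoly (M : ℝ) {r : ℝ} (hr : 0 < r) :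
    ∃ c ≥ 0, ∀ z, r ≤ ‖z - x‖ → M ≤ testPoly x p B c z := by
  refine ⟨|M| / r ^ 4 + ‖p‖ / r ^ 3 + ‖B‖ / 2 / r ^ 2, by positivity, fun z hz => ?_⟩
  have hscale (k : ℕ) {a : ℝ} (ha : 0 ≤ a) : a ≤ a / r ^ k * ‖z - x‖ ^ k := by
    rw [div_mul_eq_mul_div, le_div_iff₀ (by positivity)]
    gcongr
  have hlin : -(‖p‖ * ‖z - x‖) ≤ ⟪p, z - x⟫ := (abs_le.1 (abs_real_inner_le_norm _ _)).1
  have hquad : -(‖B‖ * ‖z - x‖ ^ 2) ≤ ⟪B (z - x), z - x⟫ := by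
    have hle : ‖B (z - x)‖ * ‖z - x‖ ≤ ‖B‖ * ‖z - x‖ * ‖z - x‖ := by
      gcongr
      exact B.le_opNorm _
    linarith [(abs_le.1 (abs_real_inner_le_norm (B (z - x)) (z - x))).1]
  have hM := hscale 4 (abs_nonneg M)
  have hp := mul_le_mul_of_nonneg_right (hscale 3 (norm_nonneg p)) (norm_nonneg (z - x))
  have hB := mul_le_mul_of_nonneg_right (hscale 2 (by positivity : 0 ≤ ‖B‖ / 2)) (sq_nonneg ‖z - x‖)
  rw [testPoly]
  linarith [le_abs_self M]

theorem exists_isMaxOn_sub_testPoly {Ω : Set E} {w : E → ℝ} (hw : BddAbove (w '' Ω))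
    (hexp : HasSecondOrderExpansion w p B x) {η : ℝ} (hη : 0 < η) :
    ∃ c, IsMaxOn (fun z => w z - testPoly x p (B + (2 * η) • .id ℝ E) c z) Ω x := by
  obtain ⟨r, hr, hball⟩ := Metric.eventually_nhds_iff_ball.1 (hexp.isLittleO.def hη)
  obtain ⟨M, hM⟩ := hw
  obtain ⟨c, hc, hfar⟩ := exists_forall_norm_ge_le_testPoly (x := x) (p := p)
    (B := B + (2 * η) • .id ℝ E) (M - w x) hr
  refine ⟨c, isMaxOn_iff.2 fun z hz => ?_⟩
  have hself : testPoly x p (B + (2 * η) • .id ℝ E) c x = 0 := by simp [testPoly]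
  rw [hself, sub_zero]
  by_cases hzr : z ∈ ball x r
  · have hnear := le_of_abs_le (hball z hzr)
    have hquartic : 0 ≤ c * (‖z - x‖ ^ 2) ^ 2 := by positivity
    rw [norm_pow, norm_norm] at hnear
    simp only [testPoly, add_apply, smul_apply, ContinuousLinearMap.id_apply, inner_add_left,
      real_inner_smul_left, real_inner_self_eq_norm_sq]
    linarith
  · have := hfar z (by simpa [dist_eq_norm] using hzr)
    linarith [hM (mem_image_of_mem w hz)]

end TestFunctions

section Jets

variable {E ι : Type*} [NormedAddCommGroup E] [InnerProductSpace ℝ E] {X : ι → E → E} {x p q : E}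
  {B D : E →L[ℝ] E}

/-- The value `(⟨p, X₁⟩, …, ⟨p, X_m⟩)` at `x` of the sub-elliptic gradient `𝔛 f` of a function with
gradient `p` at `x`. -/
noncomputable def subGradJet (X : ι → E → E) (x p : E) : ι → ℝ :=
  fun j => ⟪p, X j x⟫

/-- The value at `x` of the second derivative `𝔛𝔛⋆ f` of a function with gradient `p` and Hessian
`B` at `x`. It is symmetrized so as to be linear in `(p, B)` and symmetric for arbitrary `B`. -/
noncomputable def subHessJet (X : ι → E → E) (x p : E) (B : E →L[ℝ] E) : Matrix ι ι ℝ :=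
  Matrix.of fun i j =>
    ((⟪B (X i x), X j x⟫ + ⟪p, fderiv ℝ (X j) x (X i x)⟫) +
      (⟪B (X j x), X i x⟫ + ⟪p, fderiv ℝ (X i) x (X j x)⟫)) / 2

theorem subGradJet_neg : subGradJet X x (-p) = -subGradJet X x p :=
  funext fun _ => inner_neg_left _ _

theorem subGradJet_smul (t : ℝ) : subGradJet X x (t • p) = t • subGradJet X x p :=
  funext fun _ => real_inner_smul_left _ _ _

theorem subGradJet_zero : subGradJet X x 0 = 0 :=
  funext fun _ => inner_zero_left _

theorem subHessJet_add :
    subHessJet X x (p + q) (B + D) = subHessJet X x p B + subHessJet X x q D := by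
  ext i j
  simp only [subHessJet, Matrix.of_apply, Matrix.add_apply, inner_add_left, add_apply]
  ring

theorem subHessJet_smul (t : ℝ) : subHessJet X x (t • p) (t • B) = t • subHessJet X x p B := by
  ext i j
  simp only [subHessJet, Matrix.of_apply, Matrix.smul_apply, smul_apply, real_inner_smul_left,
    smul_eq_mul]
  ring

theorem subHessJet_neg : subHessJet X x (-p) (-B) = -subHessJet X x p B := by
  simpa only [neg_smul, one_smul] using subHessJet_smul (X := X) (x := x) (p := p) (B := B) (-1)

theorem isSymm_subHessJet : (subHessJet X x p B).IsSymm :=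
  Matrix.IsSymm.ext fun _ _ => by simp only [subHessJet, Matrix.of_apply, add_comm]

theorem subHessJet_zero_rankOne :
    subHessJet X x 0 (InnerProductSpace.rankOne ℝ q q) =
      Matrix.vecMulVec (subGradJet X x q) (subGradJet X x q) := by
  ext i j
  simp only [subHessJet, subGradJet, Matrix.of_apply, Matrix.vecMulVec_apply,
    InnerProductSpace.rankOne_apply, real_inner_smul_left, inner_zero_left]
  ring

theorem posSemidef_subHessJet [Finite ι] (hB : ∀ e, 0 ≤ ⟪B e, e⟫) :
    (subHessJet X x 0 B).PosSemidef := by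
  cases nonempty_fintype ι
  refine .of_dotProduct_mulVec_nonneg isSymm_subHessJet fun y => ?_
  have hquad : star y ⬝ᵥ (subHessJet X x 0 B *ᵥ y) =
      ⟪B (∑ i, y i • X i x), ∑ i, y i • X i x⟫ := by
    have hswap : ∑ i, ∑ j, y i * y j * ⟪B (X j x), X i x⟫ =
        ∑ i, ∑ j, y i * y j * ⟪B (X i x), X j x⟫ := by
      rw [Finset.sum_comm]
      simp only [mul_comm (y _) (y _)]
    calc star y ⬝ᵥ (subHessJet X x 0 B *ᵥ y)
        = (∑ i, ∑ j, y i * y j * ⟪B (X i x), X j x⟫ +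
            ∑ i, ∑ j, y i * y j * ⟪B (X j x), X i x⟫) / 2 := by
          simp only [dotProduct, Matrix.mulVec, subHessJet, Matrix.of_apply, star_trivial,
            inner_zero_left, add_zero, Finset.mul_sum, Finset.sum_div, ← Finset.sum_add_distrib]
          refine Finset.sum_congr rfl fun i _ => Finset.sum_congr rfl fun j _ => ?_
          ring
      _ = ∑ i, ∑ j, y i * y j * ⟪B (X j x), X i x⟫ := by rw [← hswap, add_self_div_two]
      _ = ⟪B (∑ i, y i • X i x), ∑ i, y i • X i x⟫ := by
          simp only [map_sum, map_smul, sum_inner, inner_sum, real_inner_smul_left,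
            real_inner_smul_right, mul_assoc]
  exact hquad ▸ hB _

theorem continuousAt_subGradJet (hX : ∀ j, ContinuousAt (X j) x) :
    ContinuousAt (fun j : E × E => subGradJet X j.1 j.2) (x, p) :=
  continuousAt_pi.2 fun j => continuousAt_snd.inner ((hX j).comp continuousAt_fst)

theorem continuousAt_subHessJet (hX : ∀ j, ContDiffAt ℝ 1 (X j) x) :
    ContinuousAt (fun j : E × E × (E →L[ℝ] E) => subHessJet X j.1 j.2.1 j.2.2) (x, p, B) := by
  have hfield (j : ι) : ContinuousAt (fun a : E × E × (E →L[ℝ] E) => X j a.1) (x, p, B) :=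
    (hX j).continuousAt.comp continuousAt_fst
  have hderiv (j : ι) :
      ContinuousAt (fun a : E × E × (E →L[ℝ] E) => fderiv ℝ (X j) a.1) (x, p, B) :=
    ((hX j).fderiv_right (m := 0) (by simp)).continuousAt.comp continuousAt_fst
  have hentry (i j : ι) : ContinuousAt (fun a : E × E × (E →L[ℝ] E) =>
      ⟪a.2.2 (X i a.1), X j a.1⟫ + ⟪a.2.1, fderiv ℝ (X j) a.1 (X i a.1)⟫) (x, p, B) :=
    ((continuousAt_snd.snd.clm_apply (hfield i)).inner (hfield j)).add
      (continuousAt_snd.fst.inner ((hderiv j).clm_apply (hfield i)))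
  exact continuousAt_pi.2 fun i => continuousAt_pi.2 fun j =>
    ((hentry i j).add (hentry j i)).div_const 2

end Jets

section Evaluation

variable {n m : ℕ} {X : Fin m → EuclideanSpace ℝ (Fin n) → EuclideanSpace ℝ (Fin n)}
  {f : EuclideanSpace ℝ (Fin n) → ℝ} {x p : EuclideanSpace ℝ (Fin n)}

theorem subGrad_eq_subGradJet (hf : HasGradientAt f p x) : subGrad X f x = subGradJet X x p := by
  ext j
  simp [subGrad, lieD, subGradJet, hf.hasFDerivAt.fderiv]

theorem subHess_eq_subHessJet (hX : ∀ j, DifferentiableAt ℝ (X j) x)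
    {G : EuclideanSpace ℝ (Fin n) → EuclideanSpace ℝ (Fin n)}
    {B : EuclideanSpace ℝ (Fin n) →L[ℝ] EuclideanSpace ℝ (Fin n)}
    (hG : ∀ᶠ z in 𝓝 x, HasGradientAt f (G z) z) (hB : HasFDerivAt G B x) :
    subHess X f x = subHessJet X x (G x) B := by
  have hfirst (j : Fin m) : lieD (X j) f =ᶠ[𝓝 x] fun z => ⟪G z, X j z⟫ := by
    filter_upwards [hG] with z hz
    simp [lieD, hz.hasFDerivAt.fderiv]
  have hsecond (i j : Fin m) : lieD (X i) (lieD (X j) f) x =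
      ⟪B (X i x), X j x⟫ + ⟪G x, fderiv ℝ (X j) x (X i x)⟫ := by
    rw [lieD, (hfirst j).fderiv_eq, (hB.inner ℝ (hX j).hasFDerivAt).fderiv]
    simp [fderivInnerCLM_apply, add_comm]
  ext i j
  simp only [subHess, subHessJet, Matrix.of_apply, hsecond]

end Evaluation

section Operator

variable {E ι : Type*} [NormedAddCommGroup E] [InnerProductSpace ℝ E] [Fintype ι]
  {A : (ι → ℝ) → Matrix ι ι ℝ} {H : (ι → ℝ) → ℝ} {X : ι → E → E} {x p : E} {B D : E →L[ℝ] E}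

/-- The value at `x` of `𝓛 f` for a function `f` with gradient `p` and Hessian `B` at `x`. -/
noncomputable def opJet (A : (ι → ℝ) → Matrix ι ι ℝ) (H : (ι → ℝ) → ℝ) (X : ι → E → E) (x p : E)
    (B : E →L[ℝ] E) : ℝ :=
  -(A (subGradJet X x p) * subHessJet X x p B).trace + H (subGradJet X x p)

theorem opJet_reflect :
    opJet (fun ξ => A (-ξ)) (fun ξ => -H (-ξ)) X x (-p) D = -opJet A H X x p (-D) := by
  have hhess := subHessJet_neg (X := X) (x := x) (p := p) (B := -D)
  rw [neg_neg] at hhess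
  simp only [opJet, subGradJet_neg, neg_neg, hhess, Matrix.mul_neg, Matrix.trace_neg]
  ring

theorem continuous_opJet_hessian : Continuous (opJet A H X x p) := by
  have hhess : Continuous (subHessJet X x p) := by
    unfold subHessJet
    fun_prop
  exact ((continuous_const.matrix_mul hhess).matrix_trace.neg).add continuous_const

theorem continuousAt_opJet (hX : ∀ j, ContDiffAt ℝ 1 (X j) x)
    (hA : ContinuousAt A (subGradJet X x p)) (hH : ContinuousAt H (subGradJet X x p)) :
    ContinuousAt (fun j : E × E × (E →L[ℝ] E) => opJet A H X j.1 j.2.1 j.2.2) (x, p, B) := by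
  have hgrad : ContinuousAt (fun j : E × E × (E →L[ℝ] E) => subGradJet X j.1 j.2.1) (x, p, B) :=
    ContinuousAt.comp (g := fun j : E × E => subGradJet X j.1 j.2)
      (f := fun j : E × E × (E →L[ℝ] E) => (j.1, j.2.1))
      (continuousAt_subGradJet fun j => (hX j).continuousAt) (by fun_prop)
  have hpair := (hA.comp_of_eq hgrad rfl).prodMk (continuousAt_subHessJet hX (B := B))
  exact ((continuous_fst.matrix_mul continuous_snd).matrix_trace.neg.continuousAt.comp hpair).add
    (hH.comp_of_eq hgrad rfl)

theorem trace_mul_nonneg_of_posSemidef {M N : Matrix ι ι ℝ} (hM : M.PosSemidef)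
    (hN : N.PosSemidef) : 0 ≤ (M * N).trace := by
  obtain ⟨k, w, rfl⟩ := Matrix.posSemidef_iff_eq_sum_vecMulVec.1 hM
  rw [Matrix.sum_mul, Matrix.trace_sum]
  refine Finset.sum_nonneg fun i _ => ?_
  rw [Matrix.trace_mul_comm, Matrix.mul_vecMulVec, Matrix.trace_vecMulVec, dotProduct_comm]
  exact hN.dotProduct_mulVec_nonneg (w i)

theorem opJet_anti (hA : (A (subGradJet X x p)).PosSemidef) (hle : ∀ e, ⟪B e, e⟫ ≤ ⟪D e, e⟫) :
    opJet A H X x p D ≤ opJet A H X x p B := by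
  have hdiff : subHessJet X x p D = subHessJet X x p B + subHessJet X x 0 (D - B) := by
    rw [← subHessJet_add, add_zero, add_sub_cancel]
  have htrace := trace_mul_nonneg_of_posSemidef hA (posSemidef_subHessJet (X := X) (x := x)
    (B := D - B) fun e => by rw [sub_apply, inner_sub_left]; exact sub_nonneg.2 (hle e))
  rw [opJet, opJet, hdiff, Matrix.mul_add, Matrix.trace_add]
  linarith

/-- The structural hypotheses on the coefficients of `𝓛`. They are imposed only at `ξ ≠ 0`, so
that singular operators such as the normalized `p`-Laplacian are included. -/
structure IsAdmissible (A : (ι → ℝ) → Matrix ι ι ℝ) (H : (ι → ℝ) → ℝ) (φ : ℝ → ℝ) : Prop where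
  continuousAt_diffusion : ∀ ξ, ξ ≠ 0 → ContinuousAt A ξ
  continuousAt_hamiltonian : ∀ ξ, ξ ≠ 0 → ContinuousAt H ξ
  posSemidef : ∀ ξ, ξ ≠ 0 → (A ξ).PosSemidef
  elliptic : ∀ ξ, ξ ≠ 0 → 0 < (A ξ *ᵥ ξ) ⬝ᵥ ξ
  scale_pos : ∀ s, 0 < s → s ≤ 1 → 0 < φ s
  trace_diffusion_smul_le : ∀ t : ℝ, 1 ≤ t → ∀ ξ, ξ ≠ 0 → ∀ M : Matrix ι ι ℝ, M.IsSymm →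
    -(A (t • ξ) * M).trace ≤ -(A ξ * M).trace / (t * φ (1 / t))
  hamiltonian_smul_le : ∀ t : ℝ, 1 ≤ t → ∀ ξ, ξ ≠ 0 → H (t • ξ) ≤ 1 / φ (1 / t) * H ξ

namespace IsAdmissible

variable {φ : ℝ → ℝ} {ε t : ℝ}

theorem neg_trace_add_lt_zero (h : IsAdmissible A H φ) (hε : 0 < ε) (ht : 1 ≤ t) {ξ : ι → ℝ}
    (hξ : ξ ≠ 0) {M : Matrix ι ι ℝ} (hM : M.IsSymm) (hsub : -(A ξ * M).trace + H ξ ≤ 0) :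
    -(A (t • ξ) * (t • M + ε • Matrix.vecMulVec ξ ξ)).trace + H (t • ξ) < 0 := by
  have ht0 : 0 < t := by linarith
  have hφ : 0 < φ (1 / t) := h.scale_pos _ (by positivity) ((div_le_one ht0).2 ht)
  have hsymm : (t • M + ε • Matrix.vecMulVec ξ ξ).IsSymm :=
    (hM.smul t).add (.smul (Matrix.transpose_vecMulVec ξ ξ) ε)
  have htrace : (A ξ * (t • M + ε • Matrix.vecMulVec ξ ξ)).trace =
      t * (A ξ * M).trace + ε * ((A ξ *ᵥ ξ) ⬝ᵥ ξ) := by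
    simp only [Matrix.mul_add, Matrix.trace_add, Matrix.mul_smul, Matrix.trace_smul,
      Matrix.mul_vecMulVec, Matrix.trace_vecMulVec, smul_eq_mul]
  calc -(A (t • ξ) * (t • M + ε • Matrix.vecMulVec ξ ξ)).trace + H (t • ξ)
      ≤ -(A ξ * (t • M + ε • Matrix.vecMulVec ξ ξ)).trace / (t * φ (1 / t)) +
          1 / φ (1 / t) * H ξ :=
        add_le_add (h.trace_diffusion_smul_le t ht ξ hξ _ hsymm) (h.hamiltonian_smul_le t ht ξ hξ)
    _ = 1 / φ (1 / t) * (-(A ξ * M).trace + H ξ) -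
          ε * ((A ξ *ᵥ ξ) ⬝ᵥ ξ) / (t * φ (1 / t)) := by
        rw [htrace]
        field_simp
        ring
    _ < 0 := by
        have hnonpos : 1 / φ (1 / t) * (-(A ξ * M).trace + H ξ) ≤ 0 :=
          mul_nonpos_of_nonneg_of_nonpos (by positivity) hsub
        have hell := h.elliptic ξ hξ
        have hgain : 0 < ε * ((A ξ *ᵥ ξ) ⬝ᵥ ξ) / (t * φ (1 / t)) := by positivity
        linarith

theorem opJet_convexify_neg (h : IsAdmissible A H φ) (hε : 0 < ε) (ht : 1 ≤ t)
    (hξ : subGradJet X x p ≠ 0)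
    (hsub : opJet A H X x (t⁻¹ • p)
      (t⁻¹ • (B - ε • InnerProductSpace.rankOne ℝ (t⁻¹ • p) (t⁻¹ • p))) ≤ 0) :
    opJet A H X x p B < 0 := by
  have ht0 : t ≠ 0 := by linarith
  set q := t⁻¹ • p
  set C := t⁻¹ • (B - ε • InnerProductSpace.rankOne ℝ q q)
  have hp : p = t • q := (smul_inv_smul₀ ht0 p).symm
  have hB : B = t • C + ε • InnerProductSpace.rankOne ℝ q q := by
    rw [smul_inv_smul₀ ht0, sub_add_cancel]
  have hgrad : subGradJet X x p = t • subGradJet X x q := by rw [hp, subGradJet_smul]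
  have hhess : subHessJet X x p B =
      t • subHessJet X x q C + ε • Matrix.vecMulVec (subGradJet X x q) (subGradJet X x q) := by
    rw [← subHessJet_zero_rankOne, ← subHessJet_smul, ← subHessJet_smul, ← subHessJet_add,
      smul_zero, add_zero, ← hp, ← hB]
  rw [opJet, hgrad, hhess]
  exact h.neg_trace_add_lt_zero hε ht (fun h0 => hξ (by rw [hgrad, h0, smul_zero]))
    isSymm_subHessJet hsub

end IsAdmissible


end Operator

section Viscosity

variable {n m : ℕ} {X : Fin m → EuclideanSpace ℝ (Fin n) → EuclideanSpace ℝ (Fin n)}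
  {A : (Fin m → ℝ) → Matrix (Fin m) (Fin m) ℝ} {H : (Fin m → ℝ) → ℝ}
  {Ω : Set (EuclideanSpace ℝ (Fin n))} {w : EuclideanSpace ℝ (Fin n) → ℝ}
  {x p : EuclideanSpace ℝ (Fin n)} {B : EuclideanSpace ℝ (Fin n) →L[ℝ] EuclideanSpace ℝ (Fin n)}

theorem IsViscositySubsolution.opJet_nonpos_of_isMaxOn
    (hw : IsViscositySubsolution (opL A H) X Ω w) (hx : x ∈ Ω)
    (hX : ∀ j, DifferentiableAt ℝ (X j) x) (hp : p ≠ 0) (hB : B.IsSymmetric) {c : ℝ}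
    (hmax : IsMaxOn (fun z => w z - testPoly x p B c z) Ω x) : opJet A H X x p B ≤ 0 := by
  have hgrad := hasGradientAt_testPoly (x := x) (p := p) hB c
  have hgradx : HasGradientAt (testPoly x p B c) p x := by simpa using hgrad x
  have htest := hw.2 x hx _ ⟨(contDiff_testPoly c).contDiffOn, ⟨hx, isMaxOn_iff.1 hmax⟩,
    hgradx.gradient.symm ▸ hp⟩
  rw [subGrad_eq_subGradJet hgradx, subHess_eq_subHessJet hX (.of_forall hgrad)
    (hasFDerivAt_gradient_testPoly c)] at htest
  simpa only [opL, opJet, sub_self, map_zero, add_zero, smul_zero] using htest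

theorem IsViscositySubsolution.opJet_nonpos (hw : IsViscositySubsolution (opL A H) X Ω w)
    (hbdd : BddAbove (w '' Ω)) (hx : x ∈ Ω) (hX : ∀ j, DifferentiableAt ℝ (X j) x) (hp : p ≠ 0)
    (hexp : HasSecondOrderExpansion w p B x) : opJet A H X x p B ≤ 0 := by
  have hlim : Tendsto (fun η : ℝ => opJet A H X x p (B + (2 * η) • .id ℝ _)) (𝓝[>] 0)
      (𝓝 (opJet A H X x p B)) :=
    (Continuous.tendsto' (continuous_opJet_hessian.comp (by fun_prop)) _ _ (by simp)).mono_left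
      nhdsWithin_le_nhds
  refine le_of_tendsto hlim ?_
  filter_upwards [self_mem_nhdsWithin] with η hη
  obtain ⟨c, hmax⟩ := exists_isMaxOn_sub_testPoly hbdd hexp hη
  exact hw.opJet_nonpos_of_isMaxOn hx hX hp
    (hexp.isSymmetric.add (LinearMap.IsSymmetric.id.smul (conj_trivial (2 * η)))) hmax

theorem IsViscositySubsolution.opJet_nonpos_of_mem_limitingJets
    (hw : IsViscositySubsolution (opL A H) X Ω w) (hΩ : IsOpen Ω) (hbdd : BddAbove (w '' Ω))
    (hX : ∀ j, ContDiffOn ℝ 1 (X j) Ω) (hx : x ∈ Ω) (hp : p ≠ 0)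
    (hA : ContinuousAt A (subGradJet X x p)) (hH : ContinuousAt H (subGradJet X x p))
    (hj : (x, p, B) ∈ limitingJets w) : opJet A H X x p B ≤ 0 := by
  have hC1 {z} (hz : z ∈ Ω) (j : Fin m) : ContDiffAt ℝ 1 (X j) z :=
    (hX j).contDiffAt (hΩ.mem_nhds hz)
  refine le_of_tendsto_of_frequently (continuousAt_opJet (hC1 hx) hA hH) ?_
  have hfreq := mem_closure_iff_frequently.1 hj
  have hnear : ∀ᶠ j in 𝓝 (x, p, B), j.1 ∈ Ω ∧ j.2.1 ≠ 0 :=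
    (continuousAt_fst.eventually (hΩ.mem_nhds hx)).and
      (continuousAt_snd.fst.eventually_ne hp)
  exact (hfreq.and_eventually hnear).mono fun j hj => hw.opJet_nonpos hbdd hj.2.1
    (fun i => (hC1 hj.2.1 i).differentiableAt one_ne_zero) hj.2.2 hj.1

theorem lieD_neg (V : EuclideanSpace ℝ (Fin n) → EuclideanSpace ℝ (Fin n))
    (f : EuclideanSpace ℝ (Fin n) → ℝ) : lieD V (-f) = -lieD V f := by
  ext z
  simp [lieD, fderiv_neg]

theorem IsViscositySupersolution.neg (hw : IsViscositySupersolution (opL A H) X Ω w) :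
    IsViscositySubsolution (opL (fun ξ => A (-ξ)) fun ξ => -H (-ξ)) X Ω (-w) := by
  refine ⟨hw.1.neg, fun x hx f hf => ?_⟩
  have hgrad : subGrad X (-f) x = -subGrad X f x := by
    ext j
    simp only [subGrad, lieD_neg, Pi.neg_apply]
  have hhess : subHess X (-f) x = -subHess X f x := by
    ext i j
    simp only [subHess, lieD_neg, Pi.neg_apply, Matrix.of_apply, Matrix.neg_apply]
    ring
  have htest : -f ∈ lowerTests Ω w x := by
    refine ⟨hf.1.neg, ⟨hx, fun y hy => ?_⟩, fun h0 => hf.2.2 ?_⟩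
    · have := hf.2.1.2 y hy
      simp only [Pi.neg_apply] at this ⊢
      linarith
    · simpa [gradient, fderiv_neg] using h0
  have := hw.2 x hx _ htest
  simp only [opL, hgrad, hhess, Matrix.mul_neg, Matrix.trace_neg, neg_neg] at this ⊢
  linarith

theorem IsViscositySupersolution.opJet_nonneg_of_mem_limitingJets
    (hw : IsViscositySupersolution (opL A H) X Ω w) (hΩ : IsOpen Ω) (hbdd : BddAbove ((-w) '' Ω))
    (hX : ∀ j, ContDiffOn ℝ 1 (X j) Ω) (hx : x ∈ Ω) (hp : p ≠ 0)
    (hA : ContinuousAt A (subGradJet X x p)) (hH : ContinuousAt H (subGradJet X x p))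
    (hj : (x, -p, B) ∈ limitingJets (-w)) : 0 ≤ opJet A H X x p (-B) := by
  have hgrad : -subGradJet X x (-p) = subGradJet X x p := by rw [subGradJet_neg, neg_neg]
  have hreflect := hw.neg.opJet_nonpos_of_mem_limitingJets hΩ hbdd hX hx (neg_ne_zero.2 hp)
    (ContinuousAt.comp (hgrad.symm ▸ hA) continuousAt_neg)
    (ContinuousAt.comp (hgrad.symm ▸ hH) continuousAt_neg).neg hj
  rw [opJet_reflect] at hreflect
  exact neg_nonpos.1 hreflect

end Viscosity

section Accumulation

variable {α : Type*} [TopologicalSpace α] {K : Set α} {u v : α → ℝ} {s₀ : ℝ}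

theorem isMaxOn_sub_of_tendsto_convexify {ι : Type*} {l : Filter ι} [l.NeBot] {ε : ι → ℝ}
    {y : ι → α} {y₀ : α}
    (hu : ContinuousOn u K) (hv : ContinuousOn v K) (hε : ∀ k, 0 ≤ ε k) (hε0 : Tendsto ε l (𝓝 0))
    (hyK : ∀ k, y k ∈ K)
    (hmax : ∀ k, IsMaxOn (fun z => convexify (ε k) s₀ (u z) - v z) K (y k)) (hy₀ : y₀ ∈ K)
    (hy : Tendsto y l (𝓝 y₀)) : IsMaxOn (fun z => u z - v z) K y₀ := by
  have hyw : Tendsto y l (𝓝[K] y₀) := tendsto_nhdsWithin_iff.2 ⟨hy, .of_forall hyK⟩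
  have hu_lim := (hu y₀ hy₀).tendsto.comp hyw
  have hv_lim := (hv y₀ hy₀).tendsto.comp hyw
  have hlim : Tendsto (fun k => convexify (ε k) s₀ (u (y k)) - v (y k)) l (𝓝 (u y₀ - v y₀)) := by
    have := (hu_lim.add ((hε0.div_const 2).mul ((hu_lim.sub_const s₀).pow 2))).sub hv_lim
    simpa only [convexify, Function.comp_apply, zero_div, zero_mul, add_zero] using this
  refine isMaxOn_iff.2 fun z hz => ge_of_tendsto' hlim fun k => ?_
  have hle : u z ≤ convexify (ε k) s₀ (u z) := by
    have := hε k
    exact le_add_of_nonneg_right (by positivity)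
  exact (sub_le_sub_right hle _).trans (isMaxOn_iff.1 (hmax k) z hz)

theorem exists_tendsto_isMaxOn_convexify [FirstCountableTopology α] (hK : IsCompact K)
    (hne : K.Nonempty) (hu : ContinuousOn u K) (hv : ContinuousOn v K) (s₀ : ℝ) :
    ∃ (ε : ℕ → ℝ) (y : ℕ → α), (∀ k, 0 < ε k) ∧
      (∀ k, IsMaxOn (fun z => convexify (ε k) s₀ (u z) - v z) K (y k)) ∧
      ∃ y₀ ∈ K, Tendsto y atTop (𝓝 y₀) ∧ IsMaxOn (fun z => u z - v z) K y₀ := by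
  have hε (k : ℕ) : (0 : ℝ) < 1 / (k + 1) := Nat.one_div_pos_of_nat
  choose y hyK hmax using fun k : ℕ => hK.exists_isMaxOn hne
    ((continuous_convexify (ε := 1 / (k + 1)) (s₀ := s₀)).comp_continuousOn hu |>.sub hv)
  obtain ⟨y₀, hy₀, ψ, hψ, hlim⟩ := hK.tendsto_subseq hyK
  exact ⟨_, y ∘ ψ, fun k => hε (ψ k), fun k => hmax (ψ k), y₀, hy₀, hlim,
    isMaxOn_sub_of_tendsto_convexify hu hv (fun k => (hε (ψ k)).le)
      (tendsto_one_div_add_atTop_nhds_zero_nat.comp hψ.tendsto_atTop) (fun k => hyK (ψ k))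
      (fun k => hmax (ψ k)) hy₀ hlim⟩

end Accumulation

section Comparison

variable {n m : ℕ} {X : Fin m → EuclideanSpace ℝ (Fin n) → EuclideanSpace ℝ (Fin n)}
  {A : (Fin m → ℝ) → Matrix (Fin m) (Fin m) ℝ} {H : (Fin m → ℝ) → ℝ} {φ : ℝ → ℝ}
  {Ω S : Set (EuclideanSpace ℝ (Fin n))} {u v : EuclideanSpace ℝ (Fin n) → ℝ}
  {x : EuclideanSpace ℝ (Fin n)}

theorem IsSemiconvex.exists_strongConvexOn (hu : IsSemiconvex Ω u) :
    ∃ Λ ≥ 0, ∀ s ⊆ Ω, Convex ℝ s → StrongConvexOn s (-Λ) u := by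
  obtain ⟨Λ, hΛ, hconv⟩ := hu
  refine ⟨Λ, hΛ.le, fun s hs hsc => strongConvexOn_neg_iff.2 ?_⟩
  simpa only [one_div, ← div_eq_inv_mul] using hconv s hs hsc

theorem IsViscositySubsolution.opJet_neg_of_mem_limitingJets_convexify {ε s₀ : ℝ}
    {p : EuclideanSpace ℝ (Fin n)} {B : EuclideanSpace ℝ (Fin n) →L[ℝ] EuclideanSpace ℝ (Fin n)}
    (husub : IsViscositySubsolution (opL A H) X Ω u) (hL : IsAdmissible A H φ) (hΩ : IsOpen Ω)
    (hX : ∀ j, ContDiffOn ℝ 1 (X j) Ω) (hub : BddAbove (u '' Ω)) (hu : ContinuousOn u Ω)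
    (hε : 0 < ε) (hx : x ∈ Ω) (hs₀ : s₀ ≤ u x) (hξ : subGradJet X x p ≠ 0)
    (hj : (x, p, B) ∈ limitingJets fun z => convexify ε s₀ (u z)) :
    opJet A H X x p B < 0 := by
  have hp : p ≠ 0 := by
    rintro rfl
    exact hξ subGradJet_zero
  have ht : 1 ≤ 1 + ε * (u x - s₀) :=
    le_add_of_nonneg_right (mul_nonneg hε.le (sub_nonneg.2 hs₀))
  have ht0 : 1 + ε * (u x - s₀) ≠ 0 := (one_pos.trans_le ht).ne'
  have hξ' : subGradJet X x ((1 + ε * (u x - s₀))⁻¹ • p) ≠ 0 := by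
    rw [subGradJet_smul]
    exact smul_ne_zero (inv_ne_zero ht0) hξ
  have hcont : ∀ᶠ z in 𝓝 x, ContinuousAt u z :=
    (hΩ.eventually_mem hx).mono fun z hz => hu.continuousAt (hΩ.mem_nhds hz)
  refine hL.opJet_convexify_neg hε ht hξ ?_
  exact husub.opJet_nonpos_of_mem_limitingJets hΩ hub hX hx (smul_ne_zero (inv_ne_zero ht0) hp)
    (hL.continuousAt_diffusion _ hξ') (hL.continuousAt_hamiltonian _ hξ')
    (mem_limitingJets_of_convexify hcont rfl ht0 hj)

/-- `convexify` makes the subsolution strict wherever `𝔛` of the common slope is non-zero, and a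
strict subsolution cannot touch a supersolution from below. -/
theorem exists_hasLowerParaboloid_subGradJet_eq_zero {Λ Λ' ε s₀ : ℝ} (hL : IsAdmissible A H φ)
    (hΩ : IsOpen Ω) (hX : ∀ j, ContDiffOn ℝ 1 (X j) Ω)
    (husub : IsViscositySubsolution (opL A H) X Ω u)
    (hvsup : IsViscositySupersolution (opL A H) X Ω v)
    (hub : BddAbove (u '' Ω)) (hvb : BddAbove ((-v) '' Ω))
    (hu : ContinuousOn u Ω) (hv : ContinuousOn v Ω) (hS : IsCompact S) (hSΩ : S ⊆ Ω)
    (hΛ : 0 ≤ Λ) (hΛ' : 0 ≤ Λ') (husc : StrongConvexOn S (-Λ) u)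
    (hvsc : StrongConvexOn S (-Λ') (-v)) (hε : 0 < ε) (hs₀ : ∀ z ∈ S, s₀ ≤ u z) (hx : S ∈ 𝓝 x)
    (hmax : IsMaxOn (fun z => convexify ε s₀ (u z) - v z) S x) :
    ∃ p, HasLowerParaboloid S (-v) (Λ' / 2) x (-p) ∧ subGradJet X x p = 0 := by
  have hxS : x ∈ S := mem_of_mem_nhds hx
  have hvS : ContinuousOn (-v) S := (hv.mono hSΩ).neg
  obtain ⟨s₁, hs₁⟩ := hS.bddAbove_image (hu.mono hSΩ)
  obtain ⟨Λu, hΛu, hconvex⟩ := exists_strongConvexOn_convexify hε.le hΛ husc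
    fun z hz => ⟨hs₀ z hz, hs₁ (mem_image_of_mem u hz)⟩
  have hcont : ContinuousOn (fun z => convexify ε s₀ (u z)) S :=
    continuous_convexify.comp_continuousOn (hu.mono hSΩ)
  replace hmax : IsMaxOn ((fun z => convexify ε s₀ (u z)) + -v) S x := by
    rwa [← sub_eq_add_neg]
  obtain ⟨p, hpu, hpv⟩ := exists_hasLowerParaboloid_pair_of_isMaxOn hconvex hvsc hcont hvS hx hmax
  refine ⟨p, hpv, by_contra fun hξ => ?_⟩
  have hp : p ≠ 0 := by
    rintro rfl
    exact hξ subGradJet_zero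
  obtain ⟨B, D, hB, hD, hBD⟩ := exists_mem_limitingJets_of_isMaxOn hΛu hΛ' hconvex hvsc hcont
    hvS hS hx hmax hpu hpv
  have hstrict : opJet A H X x p B < 0 :=
    husub.opJet_neg_of_mem_limitingJets_convexify hL hΩ hX hub hu hε (hSΩ hxS) (hs₀ x hxS) hξ hB
  have hsuper : 0 ≤ opJet A H X x p (-D) :=
    hvsup.opJet_nonneg_of_mem_limitingJets hΩ hvb hX (hSΩ hxS) hp
      (hL.continuousAt_diffusion _ hξ) (hL.continuousAt_hamiltonian _ hξ) hD
  have hanti : opJet A H X x p (-D) ≤ opJet A H X x p B :=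
    opJet_anti (hL.posSemidef _ hξ) fun e => by
      rw [neg_apply, inner_neg_left]
      linarith [hBD e]
  exact hstrict.not_ge (hsuper.trans hanti)

theorem exists_hasGradientAt_tendsto_slope {E : Type*} [NormedAddCommGroup E]
    [InnerProductSpace ℝ E] [CompleteSpace E] {S : Set E} {u v : E → ℝ} {x : E} {Λ Λ' : ℝ}
    (hΛ : 0 ≤ Λ) (hΛ' : 0 ≤ Λ') (husc : StrongConvexOn S (-Λ) u)
    (hvsc : StrongConvexOn S (-Λ') (-v)) (hu : ContinuousOn u S) (hv : ContinuousOn v S)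
    (hS : S ∈ 𝓝 x) (hmax : IsMaxOn (fun z => u z - v z) S x) :
    ∃ p, HasGradientAt u p x ∧ HasGradientAt v p x ∧ ∀ {y slope : ℕ → E},
      Tendsto y atTop (𝓝 x) →
      (∀ᶠ k in atTop, HasLowerParaboloid S (-v) (Λ' / 2) (y k) (-slope k)) →
      Tendsto slope atTop (𝓝 p) := by
  replace hmax : IsMaxOn (u + -v) S x := by
    rwa [← sub_eq_add_neg]
  obtain ⟨p, hpu, hpv⟩ :=
    exists_hasLowerParaboloid_pair_of_isMaxOn husc hvsc hu hv.neg hS hmax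
  obtain ⟨-, huup, hvup⟩ := hasUpperParaboloid_pair_of_add hpu hpv
    (hasUpperParaboloid_zero_of_isMaxOn hmax) hS
  refine ⟨p, huup.hasGradientAt hpu hS, ?_, fun hy hslope => ?_⟩
  · simpa only [hasGradientAt_iff_hasFDerivAt, map_neg, neg_neg] using
      (hvup.hasGradientAt hpv hS).hasFDerivAt.neg
  · have := tendsto_slope (C := Λ / 2 + Λ' / 2) (by positivity) (hvup.mono (by linarith))
      (hpv.mono (by linarith)) hS hy (hslope.mono fun k hk => hk.mono (by linarith))
    simpa only [neg_neg] using this.neg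

theorem exists_hasGradientAt_subGradJet_eq_zero {ε : ℕ → ℝ} {s₀ : ℝ}
    {y : ℕ → EuclideanSpace ℝ (Fin n)} (hL : IsAdmissible A H φ)
    (hΩ : IsOpen Ω) (hX : ∀ j, ContDiffOn ℝ 1 (X j) Ω)
    (husub : IsViscositySubsolution (opL A H) X Ω u)
    (hvsup : IsViscositySupersolution (opL A H) X Ω v)
    (hub : BddAbove (u '' Ω)) (hvb : BddAbove ((-v) '' Ω))
    (hu : ContinuousOn u Ω) (hv : ContinuousOn v Ω)
    (husc : IsSemiconvex Ω u) (hvsc : IsSemiconcave Ω v) (hε : ∀ k, 0 < ε k)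
    (hs₀ : ∀ z ∈ Ω, s₀ ≤ u z)
    (hymax : ∀ k, IsMaxOn (fun z => convexify (ε k) s₀ (u z) - v z) Ω (y k)) (hx : x ∈ Ω)
    (hy : Tendsto y atTop (𝓝 x)) (hmax : IsMaxOn (fun z => u z - v z) Ω x) :
    ∃ p, HasGradientAt u p x ∧ HasGradientAt v p x ∧ subGradJet X x p = 0 := by
  obtain ⟨Λ, hΛ, husc⟩ := husc.exists_strongConvexOn
  obtain ⟨Λ', hΛ', hvsc⟩ := IsSemiconvex.exists_strongConvexOn hvsc
  obtain ⟨R, hR, hRΩ⟩ := nhds_basis_closedBall.mem_iff.1 (hΩ.mem_nhds hx)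
  replace husc := husc _ hRΩ (convex_closedBall x R)
  replace hvsc := hvsc _ hRΩ (convex_closedBall x R)
  have hRx := closedBall_mem_nhds x hR
  obtain ⟨p, hpu, hpv, hslope_lim⟩ := exists_hasGradientAt_tendsto_slope hΛ hΛ' husc hvsc
    (hu.mono hRΩ) (hv.mono hRΩ) hRx (hmax.on_subset hRΩ)
  have hcrit : ∀ᶠ k in atTop, ∃ q, HasLowerParaboloid (closedBall x R) (-v) (Λ' / 2) (y k) (-q) ∧
      subGradJet X (y k) q = 0 := by
    filter_upwards [hy.eventually (eventually_mem_nhds_iff.2 hRx)] with k hk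
    exact exists_hasLowerParaboloid_subGradJet_eq_zero hL hΩ hX husub hvsup hub hvb hu hv
      (isCompact_closedBall x R) hRΩ hΛ hΛ' husc hvsc (hε k) (fun z hz => hs₀ z (hRΩ hz)) hk
      ((hymax k).on_subset hRΩ)
  obtain ⟨slope, hslope⟩ := hcrit.choice
  refine ⟨p, hpu, hpv, ?_⟩
  have hjet := (continuousAt_subGradJet fun j => (hX j).continuousOn.continuousAt
    (hΩ.mem_nhds hx)).tendsto.comp (hy.prodMk_nhds (hslope_lim hy (hslope.mono fun _ h => h.1)))
  exact tendsto_nhds_unique_of_eventuallyEq hjet tendsto_const_nhds (hslope.mono fun _ h => h.2)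

end Comparison


end SubElliptic

open SubElliptic Set Filter Topology in
theorem mainTheorem3_general {n m : ℕ} {Ω : Set (EuclideanSpace ℝ (Fin n))}
    (hΩ : IsOpen Ω) (hbdd : Bornology.IsBounded Ω)
    {X : Fin m → EuclideanSpace ℝ (Fin n) → EuclideanSpace ℝ (Fin n)}
    (hX : ∀ j, ContDiffOn ℝ 1 (X j) Ω)
    {A : (Fin m → ℝ) → Matrix (Fin m) (Fin m) ℝ} {H : (Fin m → ℝ) → ℝ} {φ : ℝ → ℝ}
    (hL : IsAdmissible A H φ) {u v : EuclideanSpace ℝ (Fin n) → ℝ}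
    (hu : ContinuousOn u (closure Ω)) (hv : ContinuousOn v (closure Ω))
    (husc : IsSemiconvex Ω u) (hvsc : IsSemiconcave Ω v)
    (husub : IsViscositySubsolution (opL A H) X Ω u)
    (hvsup : IsViscositySupersolution (opL A H) X Ω v)
    (hbd : ∀ x ∈ frontier Ω, u x ≤ v x)
    (hnd : (∀ x ∈ argmaxOn Ω (fun y => u y - v y), subGrad X u x ≠ 0) ∨
      (∀ x ∈ argmaxOn Ω (fun y => u y - v y), subGrad X v x ≠ 0)) :
    ∀ x ∈ Ω, u x ≤ v x := by
  by_contra! ⟨a, haΩ, hva⟩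
  have hsub : Ω ⊆ closure Ω := subset_closure
  have hK : IsCompact (closure Ω) := hbdd.isCompact_closure
  obtain ⟨s₀, hs₀⟩ := hK.bddBelow_image hu
  obtain ⟨ε, y, hε, hymax, y₀, hy₀, hy, hmax⟩ :=
    exists_tendsto_isMaxOn_convexify hK ⟨a, hsub haΩ⟩ hu hv s₀
  have hy₀Ω : y₀ ∈ Ω := by
    by_contra hnot
    have hle := hbd y₀ (hΩ.frontier_eq ▸ ⟨hy₀, hnot⟩)
    linarith [isMaxOn_iff.1 hmax a (hsub haΩ)]
  have hmaxΩ := hmax.on_subset hsub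
  obtain ⟨p, hpu, hpv, hp⟩ := exists_hasGradientAt_subGradJet_eq_zero hL hΩ hX husub hvsup
    ((hK.bddAbove_image hu).mono (image_mono hsub))
    ((hK.bddAbove_image hv.neg).mono (image_mono hsub)) (hu.mono hsub) (hv.mono hsub) husc hvsc
    hε (fun z hz => hs₀ (mem_image_of_mem u (hsub hz))) (fun k => (hymax k).on_subset hsub) hy₀Ω
    hy hmaxΩ
  have harg : y₀ ∈ argmaxOn Ω fun z => u z - v z := ⟨hy₀Ω, isMaxOn_iff.1 hmaxΩ⟩
  rcases hnd with hndu | hndv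
  · exact hndu y₀ harg ((subGrad_eq_subGradJet hpu).trans hp)
  · exact hndv y₀ harg ((subGrad_eq_subGradJet hpv).trans hp)

theorem mainTheorem3 {n m : ℕ} (Ω : Set (EuclideanSpace ℝ (Fin n)))
    (hΩ : IsOpen Ω) (hbdd : Bornology.IsBounded Ω)
    -- smooth vector fields on `Ω`
    (X : Fin m → EuclideanSpace ℝ (Fin n) → EuclideanSpace ℝ (Fin n))
    (hX : ∀ j, ContDiffOn ℝ ∞ (X j) Ω)
    -- coefficients
    (A : (Fin m → ℝ) → Matrix (Fin m) (Fin m) ℝ) (H : (Fin m → ℝ) → ℝ)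
    (hAc : Continuous A) (hHc : Continuous H)
    (hA : ∀ ξ, (A ξ).PosSemidef)
    -- strict ellipticity
    (hell : ∀ ξ, ξ ≠ 0 → 0 < (A ξ *ᵥ ξ) ⬝ᵥ ξ)
    -- scaling
    (φ : ℝ → ℝ) (hφ : ∀ s, 0 < s → s ≤ 1 → 0 < φ s)
    (hscaleA : ∀ t : ℝ, 1 ≤ t → ∀ ξ, ξ ≠ 0 → ∀ M : Matrix (Fin m) (Fin m) ℝ, M.IsSymm →
      -(A (t • ξ) * M).trace ≤ -(A ξ * M).trace / (t * φ (1 / t)))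
    (hscaleH : ∀ t : ℝ, 1 ≤ t → ∀ ξ, ξ ≠ 0 → H (t • ξ) ≤ 1 / φ (1 / t) * H ξ)
    (u v : EuclideanSpace ℝ (Fin n) → ℝ)
    (hu : ContinuousOn u (closure Ω)) (hv : ContinuousOn v (closure Ω))
    (husc : SubElliptic.IsSemiconvex Ω u) (hvsc : SubElliptic.IsSemiconcave Ω v)
    (husub : SubElliptic.IsViscositySubsolution (SubElliptic.opL A H) X Ω u)
    (hvsup : SubElliptic.IsViscositySupersolution (SubElliptic.opL A H) X Ω v)
    (hbd : ∀ x ∈ frontier Ω, u x ≤ v x)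
    (hnd : (∀ x ∈ SubElliptic.argmaxOn Ω (fun y => u y - v y), SubElliptic.subGrad X u x ≠ 0) ∨
      (∀ x ∈ SubElliptic.argmaxOn Ω (fun y => u y - v y), SubElliptic.subGrad X v x ≠ 0)) :
    ∀ x ∈ Ω, u x ≤ v x := by
  exact mainTheorem3_general hΩ hbdd (fun j => (hX j).of_le (mod_cast le_top))
    ⟨fun ξ _ => hAc.continuousAt, fun ξ _ => hHc.continuousAt, fun ξ _ => hA ξ, hell, hφ,
      hscaleA, hscaleH⟩ hu hv husc hvsc husub hvsup hbd hnd
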